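/- Let $\kappa$ be an uncountable regular cardinal. **Notation.** For a pair of ordinals $x=\langle a,b\rangle$ write $l(x)=a$ (the level of $x$) and $o(x)=b$ (the order of $x$). "Limit ordinal" means nonzero limit ordinal. A set $A\subseteq\delta$ is unbounded in the ordinal $\delta$ if for every $\beta<\delta$ there is $\xi\in A$ with $\beta<\xi$, and closed in $\delta$ if it contains every limit $\varepsilon<\delta$ such that $A\cap\varepsilon$ is unbounded in $\varepsilon$. A function $\pi:\alpha\to\beta$ between ordinals is *SLOOP* if $\pi(\gamma+1)=\pi(\gamma)+1$ whenever $\gamma+1<\alpha$, $\pi$ maps limit ordinals to limit ordinals, $\pi(0)=0$, and $\pi$ is strictly increasing. **Morass conditions.** A $(\kappa,1)$-morass condition $p$ consists of an ordinal $\lambda<\kappa$, a set $\mathcal S\subseteq((\lambda+1)\times\kappa)\cup(\{\kappa\}\times\kappa^+)$, a tree order $\prec$ on $\mathcal S$ (a strict partial order in which the predecessors of each element are well-ordered; many roots are allowed), and for each pair $x\prec y$ a function $\pi_{xy}:o(x)+1\to o(y)+1$, such that, writing $\theta_a=\{\beta\mid\langle a,\beta\rangle\in\mathcal S\}$ and $S=\{\beta\mid\langle\kappa,\beta\rangle\in\mathcal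 S\}$, the following hold. 1. For every $a\le\lambda$, $\theta_a$ is an ordinal with $0<\theta_a<\kappa$. The set $S$ contains $0$ and is closed under ordinal successors and predecessors ($\beta\in S\iff\beta+1\in S$). 2. If $f:\mathrm{ot}(S)\to S$ is the order-preserving bijection, then $\mathrm{ot}(S)\le\theta_\lambda$ and $\langle\lambda,\nu\rangle\prec\langle\kappa,f(\nu)\rangle$ for all $\nu<\mathrm{ot}(S)$. 3. *Monotonicity*: $x\prec y$ implies $l(x)<l(y)$. *Commutativity*: $x\prec y\prec z$ implies $\pi_{yz}\circ\pi_{xy}=\pi_{xz}$. - (M.1) If $x\prec y$, then $\pi_{xy}$ is SLOOP and $\pi_{xy}(o(x))=o(y)$. - (M.2) If $x\prec y$, $\nu<o(x)$, $w=\langle l(x),\nu\rangle$ and $z=\langle l(y),\pi_{xy}(\nu)\rangle$, then $w\prec z$ and $\pi_{wz}=\pi_{xy}\restriction(\nu+1)$. - (M.3) For all $y\in\mathcal S$, $\{l(x)\mid x\prec y\}$ is closed in $l(y)$. - (M.4) For all $y\in\mathcal S$ with $l(y)\le\lambda$, if $o(y)+1\ne\theta_{l(y)}$, then $\{l(x)\mid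 x\prec y\}$ is unbounded in $l(y)$. - (M.5) For all $y\in\mathcal S$, if $\{l(x)\mid x\prec y\}$ is unbounded in $l(y)$, then $o(y)=\bigcup\{\pi_{xy}[o(x)]\mid x\prec y\}$. - (M.6) If $y$ is an immediate $\prec$-successor of $x$, $l(y)\le\lambda$, $o(x)$ is a limit ordinal, and $z=\langle l(y),\sup\pi_{xy}[o(x)]\rangle$, then $x\prec z$ and $\pi_{xz}\restriction o(x)=\pi_{xy}\restriction o(x)$. - (M.7) If $y$ is an immediate $\prec$-successor of $x$, $l(y)\le\lambda$, $l(x)<a<l(y)$, $o(x)$ is a limit ordinal, $o(y)=\sup\pi_{xy}[o(x)]$, and for every $\nu<o(x)$ there is $\gamma$ with $\langle a,\gamma\rangle\prec\langle l(y),\pi_{xy}(\nu)\rangle$, then there is $\gamma$ with $\langle a,\gamma\rangle\prec y$. The components of $p$ are denoted $\mathcal S^p,\prec^p,\pi^p,\lambda^p,S^p$. An ordinal $a\le\lambda^p$ is a *mangal* of $p$ if whenever $x\prec^p y$ and $l(x)<a<l(y)$, there is $z\in\mathcal S^p$ with $l(z)=a$ and $x\prec^p z\prec^p y$. **Mangrove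 forcing.** $\mathbb P_\kappa$ is the set of $(\kappa,1)$-morass conditions together with an extra maximum element $\mathbf 1$, where for morass conditions $q\le p$ means: $\mathcal S^p\subseteq\mathcal S^q$; $\mathcal S^p\cap((\lambda^p+1)\times\kappa)=\mathcal S^q\cap((\lambda^p+1)\times\kappa)$; $\prec^p$ is the restriction of $\prec^q$ to $\mathcal S^p$; $\pi^p_{xy}=\pi^q_{xy}$ whenever $x\prec^p y$; and $\lambda^p$ is a mangal of $q$. For $\alpha\le\kappa^+$, $\mathbb P_{\kappa,\alpha}$ is the suborder of $\mathbb P_\kappa$ consisting of $\mathbf 1$ and the morass conditions $p$ with $S^p\subseteq\alpha$. **Complete embeddings.** Elements $p,q$ of a partial order are compatible if some $r$ satisfies $r\le p$ and $r\le q$, and incompatible ($p\perp q$) otherwise. A map $i:P\to Q$ of partial orders is a complete embedding if (1) $p'\le p$ implies $i(p')\le i(p)$; (2) $p\perp p'$ if and only if $i(p)\perp i(p')$; and (3) for every $q\in Q$ there is $p\in P$ such that for all $p'\le p$ in $P$, $i(p')$ is compatible with $q$. **Proposition.** Let $\alpha\le\kappa^+$ be a limit ordinal. The inclusion $\mathbb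 P_{\kappa,\alpha}\hookrightarrow\mathbb P_\kappa$ is a complete embedding if and only if $\mathrm{cf}(\alpha)=\kappa$ or $\alpha=\kappa^+$. -/

import Mathlib

universe u

namespace Mangrove

/-- A node `x = ⟨l(x), o(x)⟩` is an ordered pair of ordinals: `x.1` is its level `l(x)` and
`x.2` is its order `o(x)`. -/
abbrev Node : Type (u + 1) := Ordinal.{u} × Ordinal.{u}

/-- The set `{β | ⟨a, β⟩ ∈ S}` of orders of the nodes of `S` at level `a`. When this set is an
ordinal `θ` in the sense of von Neumann, it is `Set.Iio θ`, and `θ` is written `θ_a`. -/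
def level (S : Set Node.{u}) (a : Ordinal.{u}) : Set Ordinal.{u} := {b | (a, b) ∈ S}

/-- A set `A` of ordinals below `δ` is unbounded in `δ`. -/
def UnboundedIn (A : Set Ordinal.{u}) (δ : Ordinal.{u}) : Prop := ∀ β < δ, ∃ ξ ∈ A, β < ξ

/-- `A` is closed in `δ`: it contains each `ε < δ` that is a limit of elements of `A`. -/
def ClosedIn (A : Set Ordinal.{u}) (δ : Ordinal.{u}) : Prop :=
  ∀ ε < δ, 0 < ε → (∀ β < ε, ∃ ξ ∈ A, β < ξ ∧ ξ < ε) → ε ∈ A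

/-- The restriction of `g` to the ordinal `α` preserves successors, limits, zero and order. -/
structure IsSLOOP (α : Ordinal.{u}) (g : Ordinal.{u} → Ordinal.{u}) : Prop where
  map_succ : ∀ γ, γ + 1 < α → g (γ + 1) = g γ + 1
  map_limit : ∀ γ < α, Order.IsSuccLimit γ → Order.IsSuccLimit (g γ)
  map_zero : 0 < α → g 0 = 0
  map_lt : ∀ γ δ, γ < δ → δ < α → g γ < g δ

/-- `r` is a tree order on `S` (possibly with many roots): a strict partial order on `S` such that
the predecessors of every node are well-ordered. -/
structure IsTreeOrder (S : Set Node.{u}) (r : Node.{u} → Node.{u} → Prop) : Prop where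
  mem : ∀ x y, r x y → x ∈ S ∧ y ∈ S
  irrefl : ∀ x, ¬ r x x
  trans : ∀ x y z, r x y → r y z → r x z
  wellOrdered : ∀ y, ∀ A : Set Node.{u}, (∀ x ∈ A, r x y) → A.Nonempty →
    ∃ m ∈ A, ∀ x ∈ A, x = m ∨ r m x

/-- `y` is an immediate successor of `x`. -/
def ImmSucc (r : Node.{u} → Node.{u} → Prop) (x y : Node.{u}) : Prop :=
  r x y ∧ ∀ z, ¬ (r x z ∧ r z y)

/-- The set `{l(x) | x ≺ y}` of levels of the predecessors of `y`. -/
def predLevels (r : Node.{u} → Node.{u} → Prop) (y : Node.{u}) : Set Ordinal.{u} :=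
  {a | ∃ x, r x y ∧ x.1 = a}

/-- A `(κ, 1)`-morass condition. The function `π_{xy} : o(x) + 1 → o(y) + 1` for `x ≺ y` is given by
the values `π x y γ` with `γ ≤ o(x)`; all values of `π` that carry no information are set to `0`,
so that two conditions with the same nodes, order and functions are equal. -/
@[ext]
structure MorassCondition (κ : Cardinal.{u}) where
  /-- The set of nodes. -/
  S : Set Node.{u}
  /-- The tree order. -/
  rel : Node.{u} → Node.{u} → Prop
  /-- The functions between the nodes. -/
  π : Node.{u} → Node.{u} → Ordinal.{u} → Ordinal.{u}
  /-- The top level `λ` below `κ`. -/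
  lam : Ordinal.{u}
  lam_lt : lam < κ.ord
  S_subset : ∀ x ∈ S, (x.1 ≤ lam ∧ x.2 < κ.ord) ∨ (x.1 = κ.ord ∧ x.2 < (Order.succ κ).ord)
  tree : IsTreeOrder S rel
  π_mapsTo : ∀ x y, rel x y → ∀ γ ≤ x.2, π x y γ ≤ y.2
  π_default : ∀ x y γ, ¬ (rel x y ∧ γ ≤ x.2) → π x y γ = 0
  /-- Left-alignment at the levels up to `λ`. -/
  leftAligned : ∀ a ≤ lam, ∃ θ, 0 < θ ∧ θ < κ.ord ∧ level S a = Set.Iio θ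
  zero_mem : 0 ∈ level S κ.ord
  succ_mem : ∀ β ∈ level S κ.ord, β + 1 ∈ level S κ.ord
  pred_mem : ∀ β, β + 1 ∈ level S κ.ord → β ∈ level S κ.ord
  /-- `ot` is the order type of the level-`κ` set and `f` the order-preserving bijection from
  `ot` to this set; `ot ≤ θ_λ`, and `⟨λ, ν⟩ ≺ ⟨κ, f(ν)⟩` for `ν < ot`. -/
  top : ∃ (ot : Ordinal.{u}) (f : Ordinal.{u} → Ordinal.{u}),
    StrictMonoOn f (Set.Iio ot) ∧ f '' Set.Iio ot = level S κ.ord ∧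
      Set.Iio ot ⊆ level S lam ∧ ∀ ν < ot, rel (lam, ν) (κ.ord, f ν)
  monotone : ∀ x y, rel x y → x.1 < y.1
  comm : ∀ x y z, rel x y → rel y z → ∀ γ ≤ x.2, π y z (π x y γ) = π x z γ
  M1 : ∀ x y, rel x y → IsSLOOP (x.2 + 1) (π x y) ∧ π x y x.2 = y.2
  M2 : ∀ x y, rel x y → ∀ ν < x.2, rel (x.1, ν) (y.1, π x y ν) ∧
    ∀ γ ≤ ν, π (x.1, ν) (y.1, π x y ν) γ = π x y γ
  M3 : ∀ y ∈ S, ClosedIn (predLevels rel y) y.1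
  M4 : ∀ y ∈ S, y.1 ≤ lam → level S y.1 ≠ Set.Iio (y.2 + 1) → UnboundedIn (predLevels rel y) y.1
  M5 : ∀ y ∈ S, UnboundedIn (predLevels rel y) y.1 →
    Set.Iio y.2 = {μ | ∃ x, rel x y ∧ μ ∈ π x y '' Set.Iio x.2}
  M6 : ∀ x y, ImmSucc rel x y → y.1 ≤ lam → Order.IsSuccLimit x.2 →
    rel x (y.1, sSup (π x y '' Set.Iio x.2)) ∧
      ∀ γ < x.2, π x (y.1, sSup (π x y '' Set.Iio x.2)) γ = π x y γ
  M7 : ∀ x y, ImmSucc rel x y → y.1 ≤ lam → ∀ a, x.1 < a → a < y.1 → Order.IsSuccLimit x.2 →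
    y.2 = sSup (π x y '' Set.Iio x.2) →
    (∀ ν < x.2, ∃ γ, rel (a, γ) (y.1, π x y ν)) → ∃ γ, rel (a, γ) y

namespace MorassCondition

variable {κ : Cardinal.{u}}

/-- The set `S^p` of ordinals `β` such that `⟨κ, β⟩` is a node of `p`. -/
def topSet (p : MorassCondition κ) : Set Ordinal.{u} := level p.S κ.ord

/-- `a ≤ λ` is a mangal of `p`: every edge across level `a` factors through level `a`. -/
def IsMangal (p : MorassCondition κ) (a : Ordinal.{u}) : Prop :=
  a ≤ p.lam ∧ ∀ x ∈ p.S, ∀ y ∈ p.S, p.rel x y → x.1 < a → a < y.1 →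
    ∃ z ∈ p.S, z.1 = a ∧ p.rel x z ∧ p.rel z y

/-- `q.Extends p` is the relation `q ≤ p` of mangrove forcing. -/
structure Extends (q p : MorassCondition κ) : Prop where
  subset : p.S ⊆ q.S
  inter_eq : p.S ∩ {x | x.1 ≤ p.lam ∧ x.2 < κ.ord} = q.S ∩ {x | x.1 ≤ p.lam ∧ x.2 < κ.ord}
  rel_iff : ∀ x ∈ p.S, ∀ y ∈ p.S, (p.rel x y ↔ q.rel x y)
  π_eq : ∀ x y, p.rel x y → ∀ γ ≤ x.2, p.π x y γ = q.π x y γ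
  mangal : q.IsMangal p.lam

theorem Extends.refl (p : MorassCondition κ) : p.Extends p where
  subset := subset_rfl
  inter_eq := rfl
  rel_iff _ _ _ _ := Iff.rfl
  π_eq _ _ _ _ _ := rfl
  mangal := by
    refine ⟨le_rfl, fun x _ y hy h hx hl => ?_⟩
    rcases p.S_subset y hy with h1 | h1
    · exact absurd h1.1 (not_le.2 hl)
    obtain ⟨ot, f, -, hf, -, hr⟩ := p.top
    have hy2 : y.2 ∈ f '' Set.Iio ot := by
      rw [hf]
      change (κ.ord, y.2) ∈ p.S
      rw [← h1.1]
      exact hy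
    obtain ⟨ν, hν, hfν⟩ := hy2
    have hz : p.rel (p.lam, ν) y := by
      have := hr ν hν
      rw [hfν, ← h1.1] at this
      exact this
    refine ⟨(p.lam, ν), (p.tree.mem _ _ hz).1, rfl, ?_, hz⟩
    obtain ⟨m, hm, hmin⟩ := p.tree.wellOrdered y {x, (p.lam, ν)}
      (by rintro w (rfl | rfl) <;> assumption) ⟨x, by simp⟩
    have e1 := hmin x (by simp)
    have e2 := hmin (p.lam, ν) (by simp)
    rcases hm with rfl | rfl
    · rcases e2 with e | e
      · rw [← e] at hx
        exact absurd hx (lt_irrefl _)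
      · exact e
    · rcases e1 with e | e
      · rw [e] at hx
        exact absurd hx (lt_irrefl _)
      · exact absurd (p.monotone _ _ e) (not_lt.2 hx.le)

theorem Extends.trans {p q r : MorassCondition κ} (hrq : r.Extends q) (hqp : q.Extends p) :
    r.Extends p where
  subset := hqp.subset.trans hrq.subset
  inter_eq := by
    have hl := hqp.mangal.1
    rw [hqp.inter_eq]
    ext x
    have := Set.ext_iff.1 hrq.inter_eq x
    simp only [Set.mem_inter_iff, Set.mem_ofPred_eq] at this ⊢
    constructor
    · rintro ⟨h1, h2, h3⟩
      exact ⟨hrq.subset h1, h2, h3⟩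
    · rintro ⟨h1, h2, h3⟩
      exact ⟨(this.2 ⟨h1, h2.trans hl, h3⟩).1, h2, h3⟩
  rel_iff x hx y hy :=
    (hqp.rel_iff x hx y hy).trans (hrq.rel_iff x (hqp.subset hx) y (hqp.subset hy))
  π_eq x y h γ hγ := by
    obtain ⟨hx, hy⟩ := p.tree.mem x y h
    rw [hqp.π_eq x y h γ hγ, hrq.π_eq x y ((hqp.rel_iff x hx y hy).1 h) γ hγ]
  mangal := by
    have hl := hqp.mangal.1
    have low : ∀ x ∈ r.S, x.1 ≤ q.lam → x ∈ q.S := by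
      intro x hx hxl
      have hk : x.2 < κ.ord := by
        rcases r.S_subset x hx with h | h
        · exact h.2
        · exact absurd (hxl.trans_lt q.lam_lt) (by rw [h.1]; exact lt_irrefl _)
      exact (hrq.inter_eq.symm.subset ⟨hx, hxl, hk⟩).1
    have key : ∀ x ∈ r.S, ∀ y ∈ r.S, r.rel x y → x.1 < p.lam → p.lam < y.1 → y.1 ≤ q.lam →
        ∃ z ∈ r.S, z.1 = p.lam ∧ r.rel x z ∧ r.rel z y := by
      intro x hx y hy h h1 h2 h3
      have hx' := low x hx (h1.le.trans hl)
      have hy' := low y hy h3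
      obtain ⟨z, hz, hz1, hz2, hz3⟩ :=
        hqp.mangal.2 x hx' y hy' ((hrq.rel_iff x hx' y hy').2 h) h1 h2
      exact ⟨z, hrq.subset hz, hz1, (hrq.rel_iff x hx' z hz).1 hz2, (hrq.rel_iff z hz y hy').1 hz3⟩
    refine ⟨hl.trans hrq.mangal.1, fun x hx y hy h h1 h2 => ?_⟩
    rcases le_or_gt y.1 q.lam with h3 | h3
    · exact key x hx y hy h h1 h2 h3
    · obtain ⟨w, hw, hw1, hw2, hw3⟩ := hrq.mangal.2 x hx y hy h (h1.trans_le hl) h3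
      rcases hl.eq_or_lt with e | e
      · exact ⟨w, hw, hw1.trans e.symm, hw2, hw3⟩
      · obtain ⟨z, hz, hz1, hz2, hz3⟩ := key x hx w hw hw2 h1 (by rw [hw1]; exact e) hw1.le
        exact ⟨z, hz, hz1, hz2, r.tree.trans _ _ _ hz3 hw3⟩

theorem Extends.antisymm {p q : MorassCondition κ} (h1 : p.Extends q) (h2 : q.Extends p) :
    p = q := by
  have hS : p.S = q.S := h2.subset.antisymm h1.subset
  have hr : ∀ x y, p.rel x y ↔ q.rel x y := by
    intro x y
    constructor
    · intro h
      obtain ⟨hx, hy⟩ := p.tree.mem x y h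
      exact (h2.rel_iff x hx y hy).1 h
    · intro h
      obtain ⟨hx, hy⟩ := q.tree.mem x y h
      exact (h1.rel_iff x hx y hy).1 h
  refine MorassCondition.ext hS (funext fun x => funext fun y => propext (hr x y)) ?_
    (h2.mangal.1.antisymm h1.mangal.1)
  funext x y γ
  by_cases h : p.rel x y ∧ γ ≤ x.2
  · exact h2.π_eq x y h.1 γ h.2
  · rw [p.π_default x y γ h, q.π_default x y γ (by rwa [← hr])]

instance : PartialOrder (MorassCondition κ) where
  le q p := q.Extends p
  le_refl := Extends.refl
  le_trans _ _ _ := Extends.trans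
  le_antisymm _ _ := Extends.antisymm

end MorassCondition

/-- The mangrove forcing `P_κ`: the morass conditions, ordered by extension (a stronger condition
is smaller), with an extra maximum element `⊤`. -/
abbrev Forcing (κ : Cardinal.{u}) : Type (u + 1) := WithTop (MorassCondition κ)

/-- The suborder `P_{κ,α}` of `P_κ`, consisting of the maximum element and of the conditions `p`
such that `S^p ⊆ α`. -/
abbrev RestrictedForcing (κ : Cardinal.{u}) (α : Ordinal.{u}) : Type (u + 1) :=
  {p : Forcing κ // ∀ c : MorassCondition κ, p = (c : Forcing κ) → c.topSet ⊆ Set.Iio α}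

/-- Two forcing conditions are compatible if they have a common extension. -/
def Compatible {P : Type*} [PartialOrder P] (p q : P) : Prop := ∃ r, r ≤ p ∧ r ≤ q

/-- Complete embeddings of partial orders: they preserve order and incompatibility, and every
condition of the target has a reduction in the source. -/
structure IsCompleteEmbedding {P Q : Type*} [PartialOrder P] [PartialOrder Q] (i : P → Q) :
    Prop where
  map_le : ∀ p p' : P, p' ≤ p → i p' ≤ i p
  incompatible_iff : ∀ p p' : P, ¬ Compatible p p' ↔ ¬ Compatible (i p) (i p')
  reduction : ∀ q : Q, ∃ p : P, ∀ p' : P, p' ≤ p → Compatible (i p') q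

end Mangrove

/-! At level κ a condition carries little information: each node there has exactly one predecessor
at level λ, and all maps into level κ are restrictions of the enumeration of S. A condition thus
amounts to a stem, its part up to λ, together with a SLOOP enumeration of limit length at most θ_λ;
conversely every such pair is a condition (`Stem.cond`, `MorassCondition.isTop`, `π_enum`).
Truncating the enumeration at a limit α turns a common extension of two conditions of P_{κ,α} into
one inside P_{κ,α} (`exists_restriction`). Incompatibility is therefore preserved for every limit α,
and only reductions are at stake.

New levels come from ordinal arithmetic. Level λ + ξ, for 0 < ξ ≤ ω^Θ, receives the orders ν with
ω^ν ∣ ξ, joined by identity maps; the morass axioms become divisibility facts. Old nodes of order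
below A continue with the same order, and a block of orders m + ι may in addition split off
successors of order A + ι (`Splitting.extend`, `extends_of_splitting`).

If cf(α) ≥ κ, the fewer than κ elements of S^q below α are bounded below α, so the part of S^q above
α can be moved to a block of consecutive ordinals σ + ι below α. The resulting p is a reduction of
q: an extension p' in P_{κ,α} cannot insert anything into the block, and splitting off a copy of it
above everything in p' restores the original tail of q (`exists_reduction`).

If neither alternative holds, then α < κ⁺ and cf(α) < κ, so some q has α in S^q and S^q ∩ α cofinal
in α (`exists_condition_cofinal`). Given a common extension of q and an alleged reduction, its
restriction to α can be extended by new levels in which only orders belonging to old nodes lie above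
old levels. The mangal property then routes the edge from level λ^q to ⟨κ, α⟩ through a node
associated with some ordinal below α, while elements of S^q between that ordinal and α must be
mapped below it, a contradiction (`exists_incompatible`). -/

namespace Mangrove

open Order Ordinal

/-! ### Ordinal arithmetic -/

theorem exists_eq_Iio_of_isLowerSet {A : Set Ordinal.{u}} (h : IsLowerSet A) {b : Ordinal.{u}}
    (hb : b ∉ A) : ∃ θ ≤ b, A = Set.Iio θ := by
  rcases h.eq_univ_or_Iio with h | ⟨θ, h⟩
  · exact absurd (h ▸ Set.mem_univ b) hb
  · exact ⟨θ, not_lt.1 fun hlt => hb (h ▸ hlt), h⟩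

/-- The remainder of ξ modulo ω^ν is still divisible by every ω^μ with μ < ν; if nonzero, it would
be at least the supremum ω^ν of these powers. This is the source of (M.7) for the new levels. -/
theorem opow_dvd_of_forall_lt {ν ξ : Ordinal.{u}} (hν : IsSuccLimit ν)
    (h : ∀ μ < ν, ω ^ μ ∣ ξ) : ω ^ ν ∣ ξ := by
  rw [dvd_iff_mod_eq_zero]
  by_contra hne
  have hlt : ξ % ω ^ ν < ω ^ ν := mod_lt _ (opow_ne_zero _ omega0_ne_zero)
  refine absurd hlt (not_lt.2 ((opow_le_of_isSuccLimit omega0_ne_zero hν).2 fun μ hμ => ?_))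
  have := h μ hμ
  rw [← div_add_mod ξ (ω ^ ν),
    dvd_add_iff ((opow_dvd_opow ω hμ.le).trans (dvd_mul_right _ _))] at this
  exact le_of_dvd hne this

/-- If ε were not a multiple of a, no multiple would lie strictly between a * (ε / a) and ε. This
yields (M.3). -/
theorem dvd_of_forall_exists_between {a ε : Ordinal.{u}} (ha : a ≠ 0)
    (h : ∀ β < ε, ∃ ξ, a ∣ ξ ∧ β < ξ ∧ ξ < ε) : a ∣ ε := by
  rw [dvd_iff_mod_eq_zero]
  by_contra hne
  have hlt : a * (ε / a) < ε := by
    conv_rhs => rw [← div_add_mod ε a]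
    exact lt_add_of_pos_right _ (pos_iff_ne_zero.2 hne)
  obtain ⟨ξ, ⟨c, rfl⟩, h1, h2⟩ := h _ hlt
  have h3 : ε / a < c := lt_of_mul_lt_mul_left h1 (zero_le)
  have h4 : a * (ε / a + 1) ≤ a * c := by
    gcongr
    exact Order.add_one_le_of_lt h3
  have h5 : ε < a * (ε / a + 1) := by
    conv_lhs => rw [← div_add_mod ε a]
    rw [mul_add_one]
    gcongr
    exact mod_lt _ ha
  exact absurd h2 (not_lt.2 (h5.le.trans h4))

/-- Here ξ = ω^ν * (ω * c) with ω * c a limit, so the multiples of ω^ν below ξ are cofinal. This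
yields (M.4). -/
theorem exists_dvd_between {ν ξ β : Ordinal.{u}} (h : ω ^ (ν + 1) ∣ ξ) (hβ : β < ξ) :
    ∃ ζ, ω ^ ν ∣ ζ ∧ β < ζ ∧ ζ < ξ := by
  obtain ⟨c, rfl⟩ := h
  have hc : c ≠ 0 := by
    rintro rfl
    simp at hβ
  rw [opow_add, opow_one, mul_assoc] at hβ ⊢
  have hl : IsSuccLimit (ω * c) := isSuccLimit_mul_left isSuccLimit_omega0 (pos_iff_ne_zero.2 hc)
  obtain ⟨d, hd, hβd⟩ := (lt_mul_iff_of_isSuccLimit hl).1 hβ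
  refine ⟨ω ^ ν * d, dvd_mul_right _ _, hβd, ?_⟩
  exact mul_lt_mul_of_pos_left hd (opow_pos _ omega0_pos)

theorem isSuccLimit_of_add_one_lt {o : Ordinal.{u}} (h0 : 0 < o) (h : ∀ ν < o, ν + 1 < o) :
    IsSuccLimit o := by
  rw [isSuccLimit_iff, isSuccPrelimit_iff_succ_lt]
  exact ⟨h0.ne', h⟩

/-! ### Successor, limit, order and zero preserving maps -/

namespace IsSLOOP

variable {α β : Ordinal.{u}} {g h : Ordinal.{u} → Ordinal.{u}}

theorem mono (hg : IsSLOOP α g) (hβ : β ≤ α) : IsSLOOP β g where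
  map_succ γ hγ := hg.map_succ γ (hγ.trans_le hβ)
  map_limit γ hγ := hg.map_limit γ (hγ.trans_le hβ)
  map_zero h0 := hg.map_zero (h0.trans_le hβ)
  map_lt γ δ h hδ := hg.map_lt γ δ h (hδ.trans_le hβ)

theorem congr (hg : IsSLOOP α g) (hh : ∀ γ < α, h γ = g γ) : IsSLOOP α h where
  map_succ γ hγ := by
    rw [hh _ hγ, hh _ ((lt_add_one γ).trans hγ), hg.map_succ γ hγ]
  map_limit γ hγ hl := by
    rw [hh _ hγ]
    exact hg.map_limit γ hγ hl
  map_zero h0 := by rw [hh _ h0, hg.map_zero h0]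
  map_lt γ δ h hδ := by
    rw [hh _ hδ, hh _ (h.trans hδ)]
    exact hg.map_lt γ δ h hδ

theorem id (α : Ordinal.{u}) : IsSLOOP α (fun γ => γ) where
  map_succ _ _ := rfl
  map_limit _ _ h := h
  map_zero _ := rfl
  map_lt _ _ h _ := h

theorem comp (hh : IsSLOOP β h) (hg : IsSLOOP α g) (hm : ∀ γ < α, g γ < β) :
    IsSLOOP α (fun γ => h (g γ)) where
  map_succ γ hγ := by
    have := hm _ hγ
    simp only [hg.map_succ γ hγ] at this ⊢
    exact hh.map_succ _ this
  map_limit γ hγ hl := hh.map_limit _ (hm _ hγ) (hg.map_limit γ hγ hl)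
  map_zero h0 := by
    have := hm _ h0
    simp only [hg.map_zero h0] at this ⊢
    exact hh.map_zero this
  map_lt γ δ h hδ := hh.map_lt _ _ (hg.map_lt _ _ h hδ) (hm _ hδ)

theorem map_le (hg : IsSLOOP α g) {γ δ : Ordinal.{u}} (h : γ ≤ δ) (hδ : δ < α) : g γ ≤ g δ := by
  rcases h.eq_or_lt with rfl | h
  · exact le_rfl
  · exact (hg.map_lt _ _ h hδ).le

theorem lt_iff (hg : IsSLOOP α g) {γ δ : Ordinal.{u}} (hγ : γ < α) (hδ : δ < α) :
    g γ < g δ ↔ γ < δ :=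
  ⟨fun h => not_le.1 fun h' => absurd h (not_lt.2 (hg.map_le h' hγ)), fun h => hg.map_lt _ _ h hδ⟩

theorem inj (hg : IsSLOOP α g) {γ δ : Ordinal.{u}} (hγ : γ < α) (hδ : δ < α) (h : g γ = g δ) :
    γ = δ := by
  rcases lt_trichotomy γ δ with h' | h' | h'
  · exact absurd h (hg.map_lt _ _ h' hδ).ne
  · exact h'
  · exact absurd h (hg.map_lt _ _ h' hγ).ne'

/-- The increasing enumeration of a set that contains `0` and is closed under successors and
predecessors is SLOOP. -/
theorem of_enum {S : Set Ordinal.{u}} {ot : Ordinal.{u}} {f : Ordinal.{u} → Ordinal.{u}}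
    (hf : StrictMonoOn f (Set.Iio ot)) (hS : f '' Set.Iio ot = S) (h0 : 0 ∈ S)
    (hs : ∀ β ∈ S, β + 1 ∈ S) (hp : ∀ β, β + 1 ∈ S → β ∈ S) :
    IsSLOOP ot f ∧ IsSuccLimit ot := by
  have step : ∀ ν < ot, ν + 1 < ot ∧ f (ν + 1) = f ν + 1 := by
    intro ν hν
    have h1 : f ν + 1 ∈ f '' Set.Iio ot := hS ▸ hs _ (hS ▸ ⟨ν, hν, rfl⟩)
    obtain ⟨μ, hμ, e⟩ := h1
    have h2 : ν < μ := by
      rw [← hf.lt_iff_lt hν hμ, e]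
      exact lt_add_one _
    have h3 : ν + 1 ≤ μ := Order.add_one_le_of_lt h2
    rcases h3.eq_or_lt with h3 | h3
    · subst h3
      exact ⟨hμ, e⟩
    · have h4 : ν + 1 < ot := h3.trans hμ
      have h5 := hf hν h4 (lt_add_one ν)
      have h6 := hf h4 hμ h3
      rw [e] at h6
      exact absurd (Order.add_one_le_of_lt h5) (not_le.2 h6)
  have hz : 0 < ot ∧ f 0 = 0 := by
    obtain ⟨ν, hν, e⟩ : 0 ∈ f '' Set.Iio ot := hS ▸ h0
    have h0 : 0 < ot := (zero_le).trans_lt hν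
    refine ⟨h0, ?_⟩
    by_contra hne
    have := hf.monotoneOn h0 hν (zero_le)
    rw [e] at this
    exact hne (nonpos_iff_eq_zero.1 this)
  refine ⟨⟨fun γ h => (step γ ((lt_add_one γ).trans h)).2, ?_, fun _ => hz.2,
    fun γ δ h hδ => hf (h.trans hδ) hδ h⟩,
    isSuccLimit_of_add_one_lt hz.1 fun ν hν => (step ν hν).1⟩
  intro γ hγ hl
  have hγ0 : 0 < γ := hl.bot_lt
  rcases zero_or_succ_or_isSuccLimit (f γ) with h | ⟨β, h⟩ | h
  · have := hf hz.1 hγ hγ0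
    rw [hz.2, h] at this
    exact absurd this (lt_irrefl _)
  -- A successor value at the limit index γ would have its predecessor in S, say f δ with δ < γ;
  -- then f (δ + 1) = f γ although δ + 1 < γ.
  · have hβ : β ∈ f '' Set.Iio ot := hS ▸ hp β (by
      rw [← Order.succ_eq_add_one, h, ← hS]
      exact ⟨γ, hγ, rfl⟩)
    obtain ⟨δ, hδ, rfl⟩ := hβ
    have h1 : δ < γ := by
      rw [← hf.lt_iff_lt hδ hγ, ← h]
      exact Order.lt_succ _
    have h2 : δ + 1 < γ := hl.succ_lt h1
    have h3 := hf (h2.trans hγ) hγ h2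
    rw [(step δ hδ).2, ← h] at h3
    exact absurd h3 (lt_irrefl _)
  · exact h

end IsSLOOP

/-- The map that agrees with `g` below `m` and with `h` from `m` on. -/
noncomputable def glue (m : Ordinal.{u}) (g h : Ordinal.{u} → Ordinal.{u}) (γ : Ordinal.{u}) :
    Ordinal.{u} := if γ < m then g γ else h (γ - m)

theorem glue_of_lt {m γ : Ordinal.{u}} {g h : Ordinal.{u} → Ordinal.{u}} (hγ : γ < m) :
    glue m g h γ = g γ := if_pos hγ

theorem glue_add {m ι : Ordinal.{u}} {g h : Ordinal.{u} → Ordinal.{u}} :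
    glue m g h (m + ι) = h ι := by
  rw [glue, if_neg (not_lt.2 le_self_add), Ordinal.add_sub_cancel]

theorem lt_or_exists_eq_add (γ m : Ordinal.{u}) : γ < m ∨ ∃ ι, γ = m + ι := by
  rcases lt_or_ge γ m with h | h
  · exact Or.inl h
  · exact Or.inr ⟨γ - m, (Ordinal.add_sub_cancel_of_le h).symm⟩

theorem lt_add_cases {γ m τ : Ordinal.{u}} (h : γ < m + τ) : γ < m ∨ ∃ ι < τ, γ = m + ι := by
  rcases lt_or_exists_eq_add γ m with h' | ⟨ι, rfl⟩
  · exact Or.inl h'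
  · exact Or.inr ⟨ι, lt_of_add_lt_add_left h, rfl⟩

theorem isSuccLimit_of_add {m ι : Ordinal.{u}} (h : IsSuccLimit (m + ι)) (hι : ι ≠ 0) :
    IsSuccLimit ι := by
  rcases isSuccLimit_add_iff.1 h with h | h
  · exact h
  · exact absurd h.1 hι

/-- As m is a limit, no successor step crosses it; but m itself is then a limit index, which is why
`hl` also demands a limit value at ι = 0. -/
theorem IsSLOOP.glue {m τ : Ordinal.{u}} {g h : Ordinal.{u} → Ordinal.{u}} (hm : IsSuccLimit m)
    (hg : IsSLOOP m g) (hs : ∀ ι, ι + 1 < τ → h (ι + 1) = h ι + 1)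
    (hl : ∀ ι < τ, ι = 0 ∨ IsSuccLimit ι → IsSuccLimit (h ι))
    (hlt : ∀ ι κ, ι < κ → κ < τ → h ι < h κ) (hgh : 0 < τ → ∀ γ < m, g γ < h 0) :
    IsSLOOP (m + τ) (glue m g h) where
  map_succ γ hγ := by
    rcases lt_or_exists_eq_add γ m with h1 | ⟨ι, rfl⟩
    · have h2 : γ + 1 < m := hm.succ_lt h1
      rw [glue_of_lt h1, glue_of_lt h2]
      exact hg.map_succ γ (hm.succ_lt h1)
    · rw [add_assoc, glue_add, glue_add]
      rw [add_assoc] at hγ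
      exact hs ι (lt_of_add_lt_add_left hγ)
  map_limit γ hγ hlim := by
    rcases lt_add_cases hγ with h1 | ⟨ι, hι, rfl⟩
    · rw [glue_of_lt h1]
      exact hg.map_limit γ h1 hlim
    · rw [glue_add]
      refine hl ι hι ?_
      by_cases h0 : ι = 0
      · exact Or.inl h0
      · exact Or.inr (isSuccLimit_of_add hlim h0)
  map_zero _ := by
    have hm0 : 0 < m := hm.bot_lt
    rw [glue_of_lt hm0]
    exact hg.map_zero hm0
  map_lt γ δ hγδ hδ := by
    rcases lt_add_cases hδ with h1 | ⟨ι, hι, rfl⟩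
    · rw [glue_of_lt h1, glue_of_lt (hγδ.trans h1)]
      exact hg.map_lt _ _ hγδ h1
    · have h0 : 0 < τ := (zero_le).trans_lt hι
      rw [glue_add]
      rcases lt_or_exists_eq_add γ m with h2 | ⟨κ, rfl⟩
      · rw [glue_of_lt h2]
        refine (hgh h0 γ h2).trans_le ?_
        rcases eq_or_ne ι 0 with rfl | hne
        · exact le_rfl
        · exact (hlt 0 ι (pos_iff_ne_zero.2 hne) hι).le
      · rw [glue_add]
        exact hlt κ ι (lt_of_add_lt_add_left hγδ) hι

/-- A strictly increasing map whose values cover `[f m, f m + τ)` is a translation from `m` on. -/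
theorem StrictMonoOn.add_of_covers {f : Ordinal.{u} → Ordinal.{u}} {A m τ : Ordinal.{u}}
    (hf : StrictMonoOn f (Set.Iio A)) (hm : m < A) (h : ∀ ι < τ, f m + ι ∈ f '' Set.Iio A) :
    ∀ ι < τ, m + ι < A ∧ f (m + ι) = f m + ι := by
  intro ι
  induction ι using WellFoundedLT.induction with
  | ind ι ih =>
  intro hι
  obtain ⟨j, hj, e⟩ := h ι hι
  have hmj : m ≤ j := by
    rw [← hf.le_iff_le hm hj, e]
    exact le_self_add
  obtain ⟨ι', rfl⟩ : ∃ ι', j = m + ι' := ⟨j - m, (Ordinal.add_sub_cancel_of_le hmj).symm⟩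
  rcases lt_trichotomy ι' ι with hlt | rfl | hlt
  · have := (ih ι' hlt (hlt.trans hι)).2
    rw [e] at this
    exact absurd (add_left_cancel this) hlt.ne'
  · exact ⟨hj, e⟩
  -- If f m + ι were attained only later, f (m + ι) would be some f m + κ with κ < ι, a value
  -- already taken at m + κ.
  · have hlt' : m + ι < m + ι' := by gcongr
    have hA : m + ι < A := hlt'.trans hj
    have h1 : f m ≤ f (m + ι) := (hf.le_iff_le hm hA).2 le_self_add
    obtain ⟨κ, e'⟩ : ∃ κ, f (m + ι) = f m + κ := ⟨_, (Ordinal.add_sub_cancel_of_le h1).symm⟩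
    have h2 := hf hA hj hlt'
    rw [e, e'] at h2
    have h3 : κ < ι := lt_of_add_lt_add_left h2
    obtain ⟨h4, h5⟩ := ih κ h3 (h3.trans hι)
    have h6 : m + ι = m + κ := hf.injOn hA h4 (e'.trans h5.symm)
    exact absurd (add_left_cancel h6) h3.ne'

/-! ### Frames -/

/-- Nodes, tree order and maps, subject to the conditions (M.1), (M.2) and (M.3) only. -/
structure Frame where
  /-- The set of nodes. -/
  S : Set Node.{u}
  /-- The tree order. -/
  rel : Node.{u} → Node.{u} → Prop
  /-- The functions between the nodes. -/
  π : Node.{u} → Node.{u} → Ordinal.{u} → Ordinal.{u}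
  mem : ∀ {x y}, rel x y → x ∈ S ∧ y ∈ S
  trans : ∀ {x y z}, rel x y → rel y z → rel x z
  linear : ∀ {x x' y}, rel x y → rel x' y → x = x' ∨ rel x x' ∨ rel x' x
  monotone : ∀ {x y}, rel x y → x.1 < y.1
  π_default : ∀ x y γ, ¬ (rel x y ∧ γ ≤ x.2) → π x y γ = 0
  comm : ∀ {x y z}, rel x y → rel y z → ∀ γ ≤ x.2, π y z (π x y γ) = π x z γ
  sloop : ∀ {x y}, rel x y → IsSLOOP (x.2 + 1) (π x y)
  π_top : ∀ {x y}, rel x y → π x y x.2 = y.2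
  restrict : ∀ {x y}, rel x y → ∀ ν < x.2, rel (x.1, ν) (y.1, π x y ν) ∧
    ∀ γ ≤ ν, π (x.1, ν) (y.1, π x y ν) γ = π x y γ
  closed : ∀ y ∈ S, ClosedIn (predLevels rel y) y.1

namespace Frame

variable (F : Frame.{u})

/-- Levels increase strictly along the order, so a predecessor of least level exists, and linearity
makes it the least one. -/
theorem isTreeOrder : IsTreeOrder F.S F.rel where
  mem _ _ := F.mem
  irrefl x h := absurd (F.monotone h) (lt_irrefl _)
  trans _ _ _ := F.trans
  wellOrdered y A hA hne := by
    obtain ⟨m, hm, hmin⟩ := WellFounded.has_min (InvImage.wf Prod.fst wellFounded_lt) A hne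
    refine ⟨m, hm, fun x hx => ?_⟩
    rcases F.linear (hA x hx) (hA m hm) with h | h | h
    · exact Or.inl h
    · exact absurd (F.monotone h) (hmin x hx)
    · exact Or.inr h

variable {F}

theorem π_le {x y : Node.{u}} (h : F.rel x y) {γ : Ordinal.{u}} (hγ : γ ≤ x.2) :
    F.π x y γ ≤ y.2 := by
  rw [← F.π_top h]
  exact (F.sloop h).map_le hγ (lt_add_one _)

theorem π_lt {x y : Node.{u}} (h : F.rel x y) {γ : Ordinal.{u}} (hγ : γ < x.2) :
    F.π x y γ < y.2 := by
  rw [← F.π_top h]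
  exact (F.sloop h).map_lt _ _ hγ (lt_add_one _)

theorem eq_of_rel_of_level_eq {x x' y : Node.{u}} (h : F.rel x y) (h' : F.rel x' y)
    (e : x.1 = x'.1) : x = x' := by
  rcases F.linear h h' with h | h | h
  · exact h
  · exact absurd e (F.monotone h).ne
  · exact absurd e (F.monotone h).ne'

variable (F)

/-- The reflexive closure of the tree order. -/
def le (x y : Node.{u}) : Prop := x = y ∨ F.rel x y

open Classical in
/-- The maps of the frame, together with the identity maps. -/
noncomputable def pi (x y : Node.{u}) (γ : Ordinal.{u}) : Ordinal.{u} :=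
  if x = y then γ else F.π x y γ

variable {F}

theorem pi_self (x : Node.{u}) (γ : Ordinal.{u}) : F.pi x x γ = γ := if_pos rfl

theorem pi_of_rel {x y : Node.{u}} (h : F.rel x y) : F.pi x y = F.π x y := by
  funext γ
  refine if_neg ?_
  rintro rfl
  exact absurd (F.monotone h) (lt_irrefl _)

theorem rel_of_rel_of_le {x y z : Node.{u}} (h : F.rel x y) (h' : F.le y z) : F.rel x z := by
  rcases h' with rfl | h'
  · exact h
  · exact F.trans h h'

theorem le_level {x y : Node.{u}} (h : F.le x y) : x.1 ≤ y.1 := by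
  rcases h with rfl | h
  · exact le_rfl
  · exact (F.monotone h).le

theorem le_linear {x x' y : Node.{u}} (h : F.le x y) (h' : F.le x' y) :
    x = x' ∨ F.rel x x' ∨ F.rel x' x := by
  rcases h with rfl | h
  · rcases h' with rfl | h'
    · exact Or.inl rfl
    · exact Or.inr (Or.inr h')
  · rcases h' with rfl | h'
    · exact Or.inr (Or.inl h)
    · exact F.linear h h'

theorem le_mem {x y : Node.{u}} (h : F.le x y) (hy : y ∈ F.S) : x ∈ F.S := by
  rcases h with rfl | h
  · exact hy
  · exact (F.mem h).1

theorem pi_sloop {x y : Node.{u}} (h : F.le x y) : IsSLOOP (x.2 + 1) (F.pi x y) := by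
  rcases h with rfl | h
  · exact (IsSLOOP.id _).congr fun γ _ => pi_self _ _
  · rw [pi_of_rel h]
    exact F.sloop h

theorem pi_top {x y : Node.{u}} (h : F.le x y) : F.pi x y x.2 = y.2 := by
  rcases h with rfl | h
  · exact pi_self _ _
  · rw [pi_of_rel h]
    exact F.π_top h

theorem pi_le {x y : Node.{u}} (h : F.le x y) {γ : Ordinal.{u}} (hγ : γ ≤ x.2) :
    F.pi x y γ ≤ y.2 := by
  rw [← pi_top h]
  exact (pi_sloop h).map_le hγ (lt_add_one _)

theorem pi_lt {x y : Node.{u}} (h : F.le x y) {γ : Ordinal.{u}} (hγ : γ < x.2) :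
    F.pi x y γ < y.2 := by
  rw [← pi_top h]
  exact (pi_sloop h).map_lt _ _ hγ (lt_add_one _)

theorem pi_comm {x y z : Node.{u}} (h : F.rel x y) (h' : F.le y z) {γ : Ordinal.{u}}
    (hγ : γ ≤ x.2) : F.pi y z (F.π x y γ) = F.pi x z γ := by
  rcases h' with rfl | h'
  · rw [pi_self, pi_of_rel h]
  · rw [pi_of_rel h', pi_of_rel (F.trans h h'), F.comm h h' γ hγ]

theorem le_restrict {x y : Node.{u}} (h : F.le x y) {ν : Ordinal.{u}} (hν : ν < x.2) :
    F.le (x.1, ν) (y.1, F.pi x y ν) ∧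
      ∀ γ ≤ ν, F.pi (x.1, ν) (y.1, F.pi x y ν) γ = F.pi x y γ := by
  rcases h with rfl | h
  · simp only [pi_self]
    exact ⟨Or.inl rfl, fun γ _ => trivial⟩
  · simp only [pi_of_rel h]
    obtain ⟨h1, h2⟩ := F.restrict h ν hν
    refine ⟨Or.inr h1, fun γ hγ => ?_⟩
    rw [pi_of_rel h1, h2 γ hγ]

end Frame

/-! ### Stacking a frame upon another -/

/-- Data for stacking the frame `U`, with levels above `lam`, upon the frame `L`, with levels up to
`lam`: the relation `base y ν` says that the node `y` of `U` is above the node `⟨lam, ν⟩` of `L`, and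
`up y` is the map from `ν + 1` to `o(y) + 1`. -/
structure Attachment (L U : Frame.{u}) (lam : Ordinal.{u}) where
  /-- The node `y` is above `⟨lam, ν⟩`. -/
  base : Node.{u} → Ordinal.{u} → Prop
  /-- The map into the node. -/
  up : Node.{u} → Ordinal.{u} → Ordinal.{u}
  le_lam : ∀ {x}, x ∈ L.S → x.1 ≤ lam
  lam_lt : ∀ {y}, y ∈ U.S → lam < y.1
  base_mem : ∀ {y ν}, base y ν → y ∈ U.S ∧ (lam, ν) ∈ L.S
  base_unique : ∀ {y ν ν'}, base y ν → base y ν' → ν = ν'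
  sloop : ∀ {y ν}, base y ν → IsSLOOP (ν + 1) (up y)
  up_top : ∀ {y ν}, base y ν → up y ν = y.2
  restrict : ∀ {y ν}, base y ν → ∀ ν' < ν, base (y.1, up y ν') ν' ∧
    ∀ γ ≤ ν', up (y.1, up y ν') γ = up y γ
  base_iff : ∀ {x y ν}, U.rel x y → (base x ν ↔ base y ν)
  comm : ∀ {x y ν}, U.rel x y → base x ν → ∀ γ ≤ ν, U.π x y (up x γ) = up y γ

namespace Attachment

variable {L U : Frame.{u}} {lam : Ordinal.{u}} (A : Attachment L U lam)

/-- The relation between nodes of the lower and nodes of the upper frame. -/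
def Mid (x y : Node.{u}) : Prop := ∃ ν, A.base y ν ∧ L.le x (lam, ν)

open Classical in
/-- The maps of the stacked frame. -/
noncomputable def map (x y : Node.{u}) (γ : Ordinal.{u}) : Ordinal.{u} :=
  if L.rel x y then L.π x y γ
  else if U.rel x y then U.π x y γ
  else if h : A.Mid x y ∧ γ ≤ x.2 then A.up y (L.pi x (lam, h.1.choose) γ)
  else 0

variable {A}

theorem Mid.level {x y : Node.{u}} (h : A.Mid x y) : x.1 ≤ lam ∧ lam < y.1 := by
  obtain ⟨ν, h1, h2⟩ := h
  exact ⟨Frame.le_level h2, A.lam_lt (A.base_mem h1).1⟩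

variable (A)

theorem level_of_rel_lower (A : Attachment L U lam) {x y : Node.{u}} (h : L.rel x y) :
    x.1 < lam ∧ y.1 ≤ lam :=
  ⟨(L.monotone h).trans_le (A.le_lam (L.mem h).2), A.le_lam (L.mem h).2⟩

theorem level_of_rel_upper (A : Attachment L U lam) {x y : Node.{u}} (h : U.rel x y) :
    lam < x.1 ∧ lam < y.1 :=
  ⟨A.lam_lt (U.mem h).1, A.lam_lt (U.mem h).2⟩

theorem map_lower {x y : Node.{u}} (h : L.rel x y) : A.map x y = L.π x y := by
  funext γ
  exact if_pos h

theorem map_upper {x y : Node.{u}} (h : U.rel x y) : A.map x y = U.π x y := by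
  funext γ
  rw [map, if_neg, if_pos h]
  intro h'
  exact absurd (A.level_of_rel_upper h).2 (not_lt.2 (A.level_of_rel_lower h').2)

theorem map_mid {x y : Node.{u}} {ν γ : Ordinal.{u}} (h : A.base y ν) (h' : L.le x (lam, ν))
    (hγ : γ ≤ x.2) : A.map x y γ = A.up y (L.pi x (lam, ν) γ) := by
  have hm : A.Mid x y := ⟨ν, h, h'⟩
  have h1 : ¬ L.rel x y := fun h1 =>
    absurd (A.level_of_rel_lower h1).2 (not_le.2 hm.level.2)
  have h2 : ¬ U.rel x y := fun h2 =>
    absurd (A.level_of_rel_upper h2).1 (not_lt.2 hm.level.1)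
  rw [map, if_neg h1, if_neg h2, dif_pos ⟨hm, hγ⟩]
  -- A node has at most one base, so the chosen witness in the definition of the map is ν.
  rw [A.base_unique hm.choose_spec.1 h]

theorem mid_sloop {x y : Node.{u}} {ν : Ordinal.{u}} (h : A.base y ν) (h' : L.le x (lam, ν)) :
    IsSLOOP (x.2 + 1) (A.map x y) :=
  ((A.sloop h).comp (Frame.pi_sloop h') fun _ hγ =>
    Order.lt_add_one_iff.2 (Frame.pi_le h' (Order.lt_add_one_iff.1 hγ))).congr fun _ hγ =>
      A.map_mid h h' (Order.lt_add_one_iff.1 hγ)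

/-- The frame `U` stacked upon the frame `L`. -/
noncomputable def stack : Frame.{u} where
  S := L.S ∪ U.S
  rel x y := L.rel x y ∨ U.rel x y ∨ A.Mid x y
  π := A.map
  mem := by
    rintro x y (h | h | ⟨ν, h1, h2⟩)
    · exact ⟨Or.inl (L.mem h).1, Or.inl (L.mem h).2⟩
    · exact ⟨Or.inr (U.mem h).1, Or.inr (U.mem h).2⟩
    · exact ⟨Or.inl (Frame.le_mem h2 (A.base_mem h1).2), Or.inr (A.base_mem h1).1⟩
  trans := by
    rintro x y z (h | h | h) (h' | h' | h')
    · exact Or.inl (L.trans h h')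
    · exact absurd (A.level_of_rel_upper h').1 (not_lt.2 (A.level_of_rel_lower h).2)
    · obtain ⟨ν, h1, h2⟩ := h'
      exact Or.inr (Or.inr ⟨ν, h1, Or.inr (Frame.rel_of_rel_of_le h h2)⟩)
    · exact absurd (A.level_of_rel_upper h).2 (not_lt.2 (A.level_of_rel_lower h').1.le)
    · exact Or.inr (Or.inl (U.trans h h'))
    · exact absurd (A.level_of_rel_upper h).2 (not_lt.2 h'.level.1)
    · exact absurd h.level.2 (not_lt.2 (A.level_of_rel_lower h').1.le)
    · obtain ⟨ν, h1, h2⟩ := h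
      exact Or.inr (Or.inr ⟨ν, (A.base_iff h').1 h1, h2⟩)
    · exact absurd h.level.2 (not_lt.2 h'.level.1)
  linear := by
    rintro x x' y (h | h | h) (h' | h' | h')
    · exact (L.linear h h').imp_right (Or.imp Or.inl Or.inl)
    · exact absurd (A.level_of_rel_upper h').2 (not_lt.2 (A.level_of_rel_lower h).2)
    · exact absurd h'.level.2 (not_lt.2 (A.level_of_rel_lower h).2)
    · exact absurd (A.level_of_rel_upper h).2 (not_lt.2 (A.level_of_rel_lower h').2)
    · exact (U.linear h h').imp_right
        (Or.imp (fun h => Or.inr (Or.inl h)) (fun h => Or.inr (Or.inl h)))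
    · obtain ⟨ν, h1, h2⟩ := h'
      exact Or.inr (Or.inr (Or.inr (Or.inr ⟨ν, (A.base_iff h).2 h1, h2⟩)))
    · exact absurd h.level.2 (not_lt.2 (A.level_of_rel_lower h').2)
    · obtain ⟨ν, h1, h2⟩ := h
      exact Or.inr (Or.inl (Or.inr (Or.inr ⟨ν, (A.base_iff h').2 h1, h2⟩)))
    · obtain ⟨ν, h1, h2⟩ := h
      obtain ⟨ν', h1', h2'⟩ := h'
      obtain rfl := A.base_unique h1 h1'
      exact (Frame.le_linear h2 h2').imp_right (Or.imp Or.inl Or.inl)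
  monotone := by
    rintro x y (h | h | h)
    · exact L.monotone h
    · exact U.monotone h
    · exact h.level.1.trans_lt h.level.2
  π_default x y γ h := by
    rw [map]
    split_ifs with h1 h2 h3
    · exact L.π_default x y γ fun h' => h ⟨Or.inl h1, h'.2⟩
    · exact U.π_default x y γ fun h' => h ⟨Or.inr (Or.inl h2), h'.2⟩
    · exact absurd ⟨Or.inr (Or.inr h3.1), h3.2⟩ h
    · rfl
  comm := by
    rintro x y z (h | h | h) (h' | h' | h') γ hγ
    · rw [A.map_lower h, A.map_lower h', A.map_lower (L.trans h h'), L.comm h h' γ hγ]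
    · exact absurd (A.level_of_rel_upper h').1 (not_lt.2 (A.level_of_rel_lower h).2)
    · obtain ⟨ν, h1, h2⟩ := h'
      rw [A.map_lower h, A.map_mid h1 h2 (Frame.π_le h hγ),
        A.map_mid h1 (Or.inr (Frame.rel_of_rel_of_le h h2)) hγ, Frame.pi_comm h h2 hγ]
    · exact absurd (A.level_of_rel_upper h).2 (not_lt.2 (A.level_of_rel_lower h').1.le)
    · rw [A.map_upper h, A.map_upper h', A.map_upper (U.trans h h'), U.comm h h' γ hγ]
    · exact absurd (A.level_of_rel_upper h).2 (not_lt.2 h'.level.1)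
    · exact absurd h.level.2 (not_lt.2 (A.level_of_rel_lower h').1.le)
    · obtain ⟨ν, h1, h2⟩ := h
      rw [A.map_mid h1 h2 hγ, A.map_upper h', A.map_mid ((A.base_iff h').1 h1) h2 hγ,
        A.comm h' h1 _ (Frame.pi_le h2 hγ)]
    · exact absurd h.level.2 (not_lt.2 h'.level.1)
  sloop := by
    rintro x y (h | h | ⟨ν, h1, h2⟩)
    · rw [A.map_lower h]
      exact L.sloop h
    · rw [A.map_upper h]
      exact U.sloop h
    · exact A.mid_sloop h1 h2
  π_top := by
    rintro x y (h | h | ⟨ν, h1, h2⟩)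
    · rw [A.map_lower h]
      exact L.π_top h
    · rw [A.map_upper h]
      exact U.π_top h
    · rw [A.map_mid h1 h2 le_rfl, Frame.pi_top h2]
      exact A.up_top h1
  restrict := by
    rintro x y (h | h | ⟨ν, h1, h2⟩) μ hμ
    · rw [A.map_lower h]
      obtain ⟨h3, h4⟩ := L.restrict h μ hμ
      refine ⟨Or.inl h3, fun γ hγ => ?_⟩
      rw [A.map_lower h3, h4 γ hγ]
    · rw [A.map_upper h]
      obtain ⟨h3, h4⟩ := U.restrict h μ hμ
      refine ⟨Or.inr (Or.inl h3), fun γ hγ => ?_⟩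
      rw [A.map_upper h3, h4 γ hγ]
    · rw [A.map_mid h1 h2 hμ.le]
      obtain ⟨h3, h4⟩ := Frame.le_restrict h2 hμ
      obtain ⟨h5, h6⟩ := A.restrict h1 _ (Frame.pi_lt h2 hμ)
      refine ⟨Or.inr (Or.inr ⟨_, h5, h3⟩), fun γ hγ => ?_⟩
      rw [A.map_mid h5 h3 hγ, A.map_mid h1 h2 (hγ.trans hμ.le), h4 γ hγ, h6]
      exact (Frame.pi_sloop h2).map_le hγ (hμ.trans (lt_add_one _))
  closed := by
    rintro y (hy | hy) ε hε h0 hlim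
    · have hiff : ∀ x, L.rel x y ∨ U.rel x y ∨ A.Mid x y ↔ L.rel x y := by
        intro x
        refine ⟨?_, Or.inl⟩
        rintro (h | h | h)
        · exact h
        · exact absurd (A.level_of_rel_upper h).2 (not_lt.2 (A.le_lam hy))
        · exact absurd h.level.2 (not_lt.2 (A.le_lam hy))
      simp only [predLevels, hiff] at hlim ⊢
      exact L.closed y hy ε hε h0 hlim
    -- Up to level `lam` the predecessors of y are those of its base node, together with that node
    -- itself, so closedness of L applies.
    · rcases le_or_gt ε lam with hle | hlt
      · have hb : ∃ ν, A.base y ν := by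
          obtain ⟨ξ, ⟨x, hx, rfl⟩, -, h2⟩ := hlim 0 h0
          rcases hx with h | h | ⟨ν, h, -⟩
          · exact absurd (A.lam_lt hy) (not_lt.2 (A.level_of_rel_lower h).2)
          · exact absurd (A.level_of_rel_upper h).1 (not_lt.2 (h2.le.trans hle))
          · exact ⟨ν, h⟩
        obtain ⟨ν, hν⟩ := hb
        rcases hle.eq_or_lt with rfl | hlt
        · exact ⟨(ε, ν), Or.inr (Or.inr ⟨ν, hν, Or.inl rfl⟩), rfl⟩
        · obtain ⟨x, hx, e⟩ := L.closed (lam, ν) (A.base_mem hν).2 ε hlt h0 (by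
            intro β hβ
            obtain ⟨ξ, ⟨x, hx, rfl⟩, h1, h2⟩ := hlim β hβ
            refine ⟨x.1, ⟨x, ?_, rfl⟩, h1, h2⟩
            rcases hx with h | h | ⟨ν', h, h'⟩
            · exact absurd (A.lam_lt hy) (not_lt.2 (A.level_of_rel_lower h).2)
            · exact absurd (A.level_of_rel_upper h).1 (not_lt.2 (h2.le.trans hle))
            · obtain rfl := A.base_unique hν h
              rcases h' with rfl | h'
              · exact absurd h2 (not_lt.2 hle)
              · exact h')
          exact ⟨x, Or.inr (Or.inr ⟨ν, hν, Or.inr hx⟩), e⟩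
      · obtain ⟨x, hx, e⟩ := U.closed y hy ε hε h0 (by
          intro β hβ
          -- Asking for levels beyond `max β lam` ensures that the nodes found belong to U.
          obtain ⟨ξ, ⟨x, hx, rfl⟩, h1, h2⟩ := hlim (max β lam) (max_lt hβ hlt)
          rw [max_lt_iff] at h1
          refine ⟨x.1, ⟨x, ?_, rfl⟩, h1.1, h2⟩
          rcases hx with h | h | h
          · exact absurd h1.2 (not_lt.2 (A.level_of_rel_lower h).1.le)
          · exact h
          · exact absurd h1.2 (not_lt.2 h.level.1))
        exact ⟨x, Or.inr (Or.inl hx), e⟩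

variable {A}

theorem stack_rel_of_le_lam {x y : Node.{u}} (hy : y.1 ≤ lam) :
    A.stack.rel x y ↔ L.rel x y := by
  refine ⟨?_, Or.inl⟩
  rintro (h | h | h)
  · exact h
  · exact absurd (A.level_of_rel_upper h).2 (not_lt.2 hy)
  · exact absurd h.level.2 (not_lt.2 hy)

theorem stack_rel_of_lt_lam {x y : Node.{u}} (hx : x.1 ≤ lam) (hy : lam < y.1) :
    A.stack.rel x y ↔ A.Mid x y := by
  refine ⟨?_, fun h => Or.inr (Or.inr h)⟩
  rintro (h | h | h)
  · exact absurd hy (not_lt.2 (A.level_of_rel_lower h).2)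
  · exact absurd (A.level_of_rel_upper h).1 (not_lt.2 hx)
  · exact h

theorem stack_rel_of_lam_lt {x y : Node.{u}} (hx : lam < x.1) :
    A.stack.rel x y ↔ U.rel x y := by
  refine ⟨?_, fun h => Or.inr (Or.inl h)⟩
  rintro (h | h | h)
  · exact absurd hx (not_lt.2 (A.level_of_rel_lower h).1.le)
  · exact h
  · exact absurd hx (not_lt.2 h.level.1)

theorem stack_level_of_le {a : Ordinal.{u}} (ha : a ≤ lam) :
    level A.stack.S a = level L.S a := by
  ext b
  refine ⟨?_, Or.inl⟩
  rintro (h | h)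
  · exact h
  · exact absurd (A.lam_lt h) (not_lt.2 ha)

theorem stack_level_of_lt {a : Ordinal.{u}} (ha : lam < a) :
    level A.stack.S a = level U.S a := by
  ext b
  refine ⟨?_, Or.inr⟩
  rintro (h | h)
  · exact absurd (A.le_lam h) (not_le.2 ha)
  · exact h

theorem predLevels_stack_of_le {y : Node.{u}} (hy : y.1 ≤ lam) :
    predLevels A.stack.rel y = predLevels L.rel y := by
  simp only [predLevels, stack_rel_of_le_lam hy]

/-- Edges of a stacked frame that cross the level `lam` factor through this level. -/
theorem stack_factors {x y : Node.{u}} (h : A.stack.rel x y) (hx : x.1 < lam) (hy : lam < y.1) :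
    ∃ ν, A.base y ν ∧ L.rel x (lam, ν) ∧ A.stack.rel (lam, ν) y := by
  obtain ⟨ν, h1, h2⟩ := (stack_rel_of_lt_lam hx.le hy).1 h
  refine ⟨ν, h1, ?_, Or.inr (Or.inr ⟨ν, h1, Or.inl rfl⟩)⟩
  rcases h2 with rfl | h2
  · exact absurd hx (lt_irrefl _)
  · exact h2

end Attachment

variable {κ : Cardinal.{u}}

/-! ### Stems -/

/-- The part of a morass condition below level `κ`. -/
structure Stem (κ : Cardinal.{u}) extends Frame.{u} where
  /-- The top level. -/
  lam : Ordinal.{u}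
  lam_lt : lam < κ.ord
  bound : ∀ {x}, x ∈ S → x.1 ≤ lam ∧ x.2 < κ.ord
  leftAligned : ∀ a ≤ lam, ∃ θ, 0 < θ ∧ θ < κ.ord ∧ level S a = Set.Iio θ
  M4 : ∀ y ∈ S, level S y.1 ≠ Set.Iio (y.2 + 1) → UnboundedIn (predLevels rel y) y.1
  M5 : ∀ y ∈ S, UnboundedIn (predLevels rel y) y.1 →
    Set.Iio y.2 = {μ | ∃ x, rel x y ∧ μ ∈ π x y '' Set.Iio x.2}
  M6 : ∀ x y, ImmSucc rel x y → IsSuccLimit x.2 →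
    rel x (y.1, sSup (π x y '' Set.Iio x.2)) ∧
      ∀ γ < x.2, π x (y.1, sSup (π x y '' Set.Iio x.2)) γ = π x y γ
  M7 : ∀ x y, ImmSucc rel x y → ∀ a, x.1 < a → a < y.1 → IsSuccLimit x.2 →
    y.2 = sSup (π x y '' Set.Iio x.2) →
    (∀ ν < x.2, ∃ γ, rel (a, γ) (y.1, π x y ν)) → ∃ γ, rel (a, γ) y

namespace Stem

/-- The stem whose only node is `⟨0, 0⟩`. -/
def root (hκ : Cardinal.aleph0 < κ) : Stem κ where
  S := {(0, 0)}
  rel _ _ := False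
  π _ _ _ := 0
  mem h := h.elim
  trans h := h.elim
  linear h := h.elim
  monotone h := h.elim
  π_default _ _ _ _ := rfl
  comm h := h.elim
  sloop h := h.elim
  π_top h := h.elim
  restrict h := h.elim
  closed y hy ε hε := by
    rw [Set.mem_singleton_iff.1 hy] at hε
    exact absurd hε not_lt_zero
  lam := 0
  lam_lt := by
    rw [Cardinal.lt_ord, card_zero]
    exact Cardinal.aleph0_pos.trans hκ
  bound hx := by
    rw [Set.mem_singleton_iff.1 hx]
    refine ⟨le_rfl, ?_⟩
    rw [Cardinal.lt_ord, card_zero]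
    exact Cardinal.aleph0_pos.trans hκ
  leftAligned a ha := by
    refine ⟨1, one_pos, ?_, ?_⟩
    · rw [Cardinal.lt_ord, card_one]
      exact Cardinal.one_lt_aleph0.trans hκ
    · rw [nonpos_iff_eq_zero.1 ha]
      ext b
      simp [level]
  M4 y hy h := by
    rw [Set.mem_singleton_iff.1 hy] at h
    refine absurd ?_ h
    ext b
    simp [level]
  M5 y hy _ := by
    rw [Set.mem_singleton_iff.1 hy]
    simp
  M6 _ _ h := h.1.elim
  M7 _ _ h := h.1.elim

section Stack

variable (L : Stem κ) {U : Frame.{u}} (A : Attachment L.toFrame U L.lam)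

theorem immSucc_of_stack {x y : Node.{u}} (hy : y.1 ≤ L.lam) (h : ImmSucc A.stack.rel x y) :
    ImmSucc L.rel x y :=
  ⟨(Attachment.stack_rel_of_le_lam hy).1 h.1, fun z hz => h.2 z ⟨Or.inl hz.1, Or.inl hz.2⟩⟩

theorem stack_π {x y : Node.{u}} (h : L.rel x y) : A.stack.π x y = L.π x y := A.map_lower h

theorem mem_of_mem_stack {y : Node.{u}} (hy : y ∈ A.stack.S) (hl : y.1 ≤ L.lam) : y ∈ L.S := by
  rcases hy with hy | hy
  · exact hy
  · exact absurd (A.lam_lt hy) (not_lt.2 hl)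

theorem stack_M4 (y : Node.{u}) (hy : y ∈ A.stack.S) (hl : y.1 ≤ L.lam)
    (h : level A.stack.S y.1 ≠ Set.Iio (y.2 + 1)) :
    UnboundedIn (predLevels A.stack.rel y) y.1 := by
  rw [Attachment.stack_level_of_le hl] at h
  rw [Attachment.predLevels_stack_of_le hl]
  exact L.M4 y (L.mem_of_mem_stack A hy hl) h

theorem stack_M5 (y : Node.{u}) (hy : y ∈ A.stack.S) (hl : y.1 ≤ L.lam)
    (h : UnboundedIn (predLevels A.stack.rel y) y.1) :
    Set.Iio y.2 = {μ | ∃ x, A.stack.rel x y ∧ μ ∈ A.stack.π x y '' Set.Iio x.2} := by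
  rw [Attachment.predLevels_stack_of_le hl] at h
  rw [L.M5 y (L.mem_of_mem_stack A hy hl) h]
  ext μ
  simp only [Set.mem_ofPred_eq, Attachment.stack_rel_of_le_lam hl]
  refine exists_congr fun x => and_congr_right fun hx => ?_
  rw [L.stack_π A hx]

theorem stack_M6 (x y : Node.{u}) (h : ImmSucc A.stack.rel x y) (hl : y.1 ≤ L.lam)
    (hx : IsSuccLimit x.2) : A.stack.rel x (y.1, sSup (A.stack.π x y '' Set.Iio x.2)) ∧
      ∀ γ < x.2, A.stack.π x (y.1, sSup (A.stack.π x y '' Set.Iio x.2)) γ = A.stack.π x y γ := by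
  have h' := L.immSucc_of_stack A hl h
  obtain ⟨h1, h2⟩ := L.M6 x y h' hx
  rw [L.stack_π A h'.1, L.stack_π A h1]
  exact ⟨Or.inl h1, h2⟩

theorem stack_M7 (x y : Node.{u}) (h : ImmSucc A.stack.rel x y) (hl : y.1 ≤ L.lam)
    (a : Ordinal.{u}) (hxa : x.1 < a) (hay : a < y.1) (hx : IsSuccLimit x.2)
    (hy : y.2 = sSup (A.stack.π x y '' Set.Iio x.2))
    (hν : ∀ ν < x.2, ∃ γ, A.stack.rel (a, γ) (y.1, A.stack.π x y ν)) :
    ∃ γ, A.stack.rel (a, γ) y := by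
  have h' := L.immSucc_of_stack A hl h
  rw [L.stack_π A h'.1] at hy hν
  obtain ⟨γ, hγ⟩ := L.M7 x y h' a hxa hay hx hy fun ν hν' =>
    (hν ν hν').imp fun _ h => (Attachment.stack_rel_of_le_lam (by exact hl)).1 h
  exact ⟨γ, Or.inl hγ⟩

end Stack

/-! ### Adding the level `κ` to a stem -/

/-- `f` can serve as the increasing enumeration, of length `ot`, of the nodes at level `κ` of a
morass condition with stem `L`. -/
structure IsTop (L : Stem κ) (ot : Ordinal.{u}) (f : Ordinal.{u} → Ordinal.{u}) : Prop where
  limit : IsSuccLimit ot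
  sloop : IsSLOOP ot f
  sub : Set.Iio ot ⊆ level L.S L.lam
  lt : ∀ ν < ot, f ν < (Order.succ κ).ord

/-- The frame of nodes at level `κ` with orders in a given set. -/
def topFrame (κ : Cardinal.{u}) (T : Set Ordinal.{u}) : Frame.{u} where
  S := {x | x.1 = κ.ord ∧ x.2 ∈ T}
  rel _ _ := False
  π _ _ _ := 0
  mem h := h.elim
  trans h := h.elim
  linear h := h.elim
  monotone h := h.elim
  π_default _ _ _ _ := rfl
  comm h := h.elim
  sloop h := h.elim
  π_top h := h.elim
  restrict h := h.elim
  closed _ _ _ _ h0 h := by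
    obtain ⟨_, ⟨_, h, _⟩, _⟩ := h 0 h0
    exact h.elim

variable {L : Stem κ} {ot : Ordinal.{u}} {f : Ordinal.{u} → Ordinal.{u}}

/-- The nodes at level `κ` placed upon a stem. -/
def IsTop.attachment (h : IsTop L ot f) :
    Attachment L.toFrame (topFrame κ (f '' Set.Iio ot)) L.lam where
  base y ν := ν < ot ∧ y = (κ.ord, f ν)
  up _ := f
  le_lam hx := (L.bound hx).1
  lam_lt hy := by
    rw [hy.1]
    exact L.lam_lt
  base_mem := by
    rintro y ν ⟨h1, rfl⟩
    exact ⟨⟨rfl, ν, h1, rfl⟩, h.sub h1⟩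
  base_unique := by
    rintro y ν ν' ⟨h1, rfl⟩ ⟨h2, e⟩
    exact h.sloop.inj h1 h2 (Prod.ext_iff.1 e).2
  sloop h' := h.sloop.mono (Order.add_one_le_of_lt h'.1)
  up_top := by
    rintro y ν ⟨-, rfl⟩
    rfl
  restrict := by
    rintro y ν ⟨h1, rfl⟩ ν' h2
    exact ⟨⟨h2.trans h1, rfl⟩, fun _ _ => rfl⟩
  base_iff h := h.elim
  comm h := h.elim

theorem IsTop.mid_iff (h : IsTop L ot f) {x : Node.{u}} {ν : Ordinal.{u}} (hν : ν < ot) :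
    h.attachment.Mid x (κ.ord, f ν) ↔ L.le x (L.lam, ν) := by
  constructor
  · rintro ⟨ν', ⟨h1, h2⟩, h3⟩
    rw [h.sloop.inj hν h1 (Prod.ext_iff.1 h2).2]
    exact h3
  · exact fun h' => ⟨ν, ⟨hν, rfl⟩, h'⟩

/-- The morass condition with a given stem and given nodes at level `κ`. -/
noncomputable def cond (L : Stem κ) (h : IsTop L ot f) : MorassCondition κ where
  S := h.attachment.stack.S
  rel := h.attachment.stack.rel
  π := h.attachment.stack.π
  lam := L.lam
  lam_lt := L.lam_lt
  S_subset := by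
    rintro x (hx | ⟨hx, ν, hν, e⟩)
    · exact Or.inl (L.bound hx)
    · exact Or.inr ⟨hx, e ▸ h.lt ν hν⟩
  tree := Frame.isTreeOrder _
  π_mapsTo x y hxy γ hγ := Frame.π_le hxy hγ
  π_default := Frame.π_default _
  leftAligned a ha := by
    rw [Attachment.stack_level_of_le ha]
    exact L.leftAligned a ha
  zero_mem := by
    rw [Attachment.stack_level_of_lt L.lam_lt]
    exact ⟨rfl, 0, h.limit.bot_lt, h.sloop.map_zero h.limit.bot_lt⟩
  succ_mem β hβ := by
    rw [Attachment.stack_level_of_lt L.lam_lt] at hβ ⊢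
    obtain ⟨-, ν, hν, rfl⟩ := hβ
    have h' : ν + 1 < ot := h.limit.succ_lt hν
    exact ⟨rfl, ν + 1, h', h.sloop.map_succ ν h'⟩
  pred_mem β hβ := by
    rw [Attachment.stack_level_of_lt L.lam_lt] at hβ ⊢
    obtain ⟨-, ν, hν, e⟩ := hβ
    change f ν = β + 1 at e
    rcases zero_or_succ_or_isSuccLimit ν with rfl | ⟨μ, rfl⟩ | hl
    · rw [h.sloop.map_zero h.limit.bot_lt] at e
      exact absurd e (Order.succ_ne_bot β).symm
    · rw [Order.succ_eq_add_one] at e hν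
      have hμ : μ < ot := (lt_add_one μ).trans hν
      rw [h.sloop.map_succ μ hν] at e
      exact ⟨rfl, μ, hμ, Order.succ_injective e⟩
    · have := h.sloop.map_limit ν hν hl
      rw [e] at this
      exact absurd this (not_isSuccLimit_succ β)
  top := by
    refine ⟨ot, f, fun a _ b hb hab => h.sloop.map_lt a b hab hb, ?_, ?_, ?_⟩
    · rw [Attachment.stack_level_of_lt L.lam_lt]
      ext b
      exact ⟨fun h => ⟨rfl, h⟩, fun h => h.2⟩
    · rw [Attachment.stack_level_of_le le_rfl]
      exact h.sub
    · intro ν hν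
      exact Or.inr (Or.inr ((h.mid_iff hν).2 (Or.inl rfl)))
  monotone x y := h.attachment.stack.monotone
  comm x y z := h.attachment.stack.comm
  M1 x y hxy := ⟨h.attachment.stack.sloop hxy, h.attachment.stack.π_top hxy⟩
  M2 x y := h.attachment.stack.restrict
  M3 := h.attachment.stack.closed
  M4 y hy hl := L.stack_M4 h.attachment y hy hl
  M5 y hy hu := by
    rcases le_or_gt y.1 L.lam with hl | hl
    · exact L.stack_M5 h.attachment y hy hl hu
    -- Predecessors of a node at level κ have level at most `lam`, so they are bounded and (M.5) is
    -- vacuous there.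
    · obtain ⟨ξ, ⟨x, hx, rfl⟩, hξ⟩ := hu _ hl
      exact ((Attachment.stack_rel_of_lam_lt hξ).1 hx).elim
  M6 x y hxy hl := L.stack_M6 h.attachment x y hxy hl
  M7 x y hxy hl := L.stack_M7 h.attachment x y hxy hl

theorem topSet_cond (h : IsTop L ot f) : (L.cond h).topSet = f '' Set.Iio ot :=
  (Attachment.stack_level_of_lt (A := h.attachment) L.lam_lt).trans (by
    ext b
    exact ⟨fun h => h.2, fun h => ⟨rfl, h⟩⟩)

theorem cond_rel_of_le_lam (h : IsTop L ot f) {x y : Node.{u}} (hy : y.1 ≤ L.lam) :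
    (L.cond h).rel x y ↔ L.rel x y := Attachment.stack_rel_of_le_lam hy

theorem cond_π_of_rel (h : IsTop L ot f) {x y : Node.{u}} (hxy : L.rel x y) :
    (L.cond h).π x y = L.π x y := L.stack_π h.attachment hxy

theorem cond_rel_top (h : IsTop L ot f) {x : Node.{u}} {ν : Ordinal.{u}} (hν : ν < ot) :
    (L.cond h).rel x (κ.ord, f ν) ↔ L.le x (L.lam, ν) := by
  refine Iff.trans ⟨?_, fun h => Or.inr (Or.inr h)⟩ (h.mid_iff hν)
  rintro (h' | h' | h')
  · exact absurd (h.attachment.level_of_rel_lower h').2 (not_le.2 L.lam_lt)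
  · exact h'.elim
  · exact h'

theorem cond_π_top (h : IsTop L ot f) {x : Node.{u}} {ν γ : Ordinal.{u}} (hν : ν < ot)
    (hx : L.le x (L.lam, ν)) (hγ : γ ≤ x.2) :
    (L.cond h).π x (κ.ord, f ν) γ = f (L.pi x (L.lam, ν) γ) :=
  h.attachment.map_mid ⟨hν, rfl⟩ hx hγ

end Stem

/-! ### Decomposing a condition into its stem and its enumeration at level κ -/

namespace Frame

open Classical in
/-- The part of a frame up to the level `lam`. -/
noncomputable def below (F : Frame.{u}) (lam : Ordinal.{u}) : Frame.{u} where
  S := {x ∈ F.S | x.1 ≤ lam}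
  rel x y := F.rel x y ∧ y.1 ≤ lam
  π x y γ := if y.1 ≤ lam then F.π x y γ else 0
  mem h := ⟨⟨(F.mem h.1).1, (F.monotone h.1).le.trans h.2⟩, (F.mem h.1).2, h.2⟩
  trans h h' := ⟨F.trans h.1 h'.1, h'.2⟩
  linear h h' := (F.linear h.1 h'.1).imp_right
    (Or.imp (fun h'' => ⟨h'', (F.monotone h'.1).le.trans h'.2⟩)
      (fun h'' => ⟨h'', (F.monotone h.1).le.trans h.2⟩))
  monotone h := F.monotone h.1
  π_default x y γ h := by
    split_ifs with hy
    · exact F.π_default x y γ fun h' => h ⟨⟨h'.1, hy⟩, h'.2⟩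
    · rfl
  comm h h' γ hγ := by
    simp only [if_pos h.2, if_pos h'.2]
    exact F.comm h.1 h'.1 γ hγ
  sloop h := by
    simp only [if_pos h.2]
    exact F.sloop h.1
  π_top h := by
    simp only [if_pos h.2]
    exact F.π_top h.1
  restrict h ν hν := by
    simp only [if_pos h.2]
    exact ⟨⟨(F.restrict h.1 ν hν).1, h.2⟩, (F.restrict h.1 ν hν).2⟩
  closed y hy := by
    simp only [predLevels, hy.2, and_true]
    exact F.closed y hy.1

end Frame

namespace MorassCondition

/-- The frame of a morass condition. -/
def frame (p : MorassCondition κ) : Frame.{u} where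
  S := p.S
  rel := p.rel
  π := p.π
  mem h := p.tree.mem _ _ h
  trans h h' := p.tree.trans _ _ _ h h'
  linear {x x' y} h h' := by
    obtain ⟨m, hm, hmin⟩ := p.tree.wellOrdered y {x, x'}
      (by rintro w (rfl | rfl) <;> assumption) ⟨x, by simp⟩
    have e1 := hmin x (by simp)
    have e2 := hmin x' (by simp)
    rcases hm with rfl | rfl
    · exact e2.imp Eq.symm Or.inl
    · exact e1.imp_right Or.inr
  monotone h := p.monotone _ _ h
  π_default := p.π_default
  comm h h' := p.comm _ _ _ h h'
  sloop h := (p.M1 _ _ h).1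
  π_top h := (p.M1 _ _ h).2
  restrict h := p.M2 _ _ h
  closed := p.M3

theorem lt_ord_of_le_lam (p : MorassCondition κ) {x : Node.{u}} (hx : x ∈ p.S)
    (hl : x.1 ≤ p.lam) : x.2 < κ.ord := by
  rcases p.S_subset x hx with h | h
  · exact h.2
  · exact absurd (h.1 ▸ hl) (not_le.2 p.lam_lt)

/-- The part of a morass condition below level `κ`. -/
noncomputable def stem (p : MorassCondition κ) : Stem κ where
  toFrame := p.frame.below p.lam
  lam := p.lam
  lam_lt := p.lam_lt
  bound hx := ⟨hx.2, p.lt_ord_of_le_lam hx.1 hx.2⟩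
  leftAligned a ha := by
    obtain ⟨θ, h1, h2, h3⟩ := p.leftAligned a ha
    refine ⟨θ, h1, h2, h3 ▸ ?_⟩
    ext b
    exact ⟨fun h => h.1, fun h => ⟨h, ha⟩⟩
  M4 y hy hl := by
    have e : level (p.frame.below p.lam).S y.1 = level p.S y.1 := by
      ext b
      exact ⟨fun h => h.1, fun h => ⟨h, hy.2⟩⟩
    rw [e] at hl
    simp only [predLevels, Frame.below, hy.2, and_true]
    exact p.M4 y hy.1 hy.2 hl
  M5 y hy hu := by
    simp only [predLevels, Frame.below, hy.2, and_true, if_true] at hu ⊢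
    exact p.M5 y hy.1 hu
  M6 x y hxy hx := by
    have hy := hxy.1.2
    simp only [Frame.below, hy, and_true, if_true]
    refine p.M6 x y ⟨hxy.1.1, fun z hz => hxy.2 z ⟨⟨hz.1, ?_⟩, hz.2, hy⟩⟩ hy hx
    exact (p.monotone _ _ hz.2).le.trans hy
  M7 x y hxy a hxa hay hx := by
    have hy := hxy.1.2
    simp only [Frame.below, hy, and_true, if_true]
    refine p.M7 x y ⟨hxy.1.1, fun z hz => hxy.2 z ⟨⟨hz.1, ?_⟩, hz.2, hy⟩⟩ hy a hxa hay hx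
    exact (p.monotone _ _ hz.2).le.trans hy

variable (p : MorassCondition κ)

theorem stem_lam : p.stem.lam = p.lam := rfl

variable {p}

theorem stem_rel_iff {x y : Node.{u}} : p.stem.rel x y ↔ p.rel x y ∧ y.1 ≤ p.lam := Iff.rfl

theorem stem_π {x y : Node.{u}} (h : p.stem.rel x y) : p.stem.π x y = p.π x y := by
  funext γ
  exact if_pos h.2

variable (p)

/-- The order type of the set of nodes at level `κ`. -/
noncomputable def height : Ordinal.{u} := p.top.choose

/-- The increasing enumeration of the set of nodes at level `κ`. -/
noncomputable def enum : Ordinal.{u} → Ordinal.{u} := p.top.choose_spec.choose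

theorem enum_strictMonoOn : StrictMonoOn p.enum (Set.Iio p.height) :=
  p.top.choose_spec.choose_spec.1

theorem image_enum : p.enum '' Set.Iio p.height = p.topSet := p.top.choose_spec.choose_spec.2.1

theorem isTop : p.stem.IsTop p.height p.enum := by
  obtain ⟨h1, h2⟩ := IsSLOOP.of_enum p.enum_strictMonoOn p.image_enum p.zero_mem p.succ_mem
    p.pred_mem
  refine ⟨h2, h1, fun ν hν => ⟨p.top.choose_spec.choose_spec.2.2.1 hν, le_rfl⟩, fun ν hν => ?_⟩
  have hmem : (κ.ord, p.enum ν) ∈ p.S := by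
    have : p.enum ν ∈ p.topSet := p.image_enum ▸ ⟨ν, hν, rfl⟩
    exact this
  rcases p.S_subset _ hmem with h | h
  · exact absurd h.1 (not_le.2 p.lam_lt)
  · exact h.2

variable {p}

theorem exists_enum_eq {β : Ordinal.{u}} (h : β ∈ p.topSet) : ∃ ν < p.height, p.enum ν = β := by
  rw [← p.image_enum] at h
  exact h

theorem enum_mem {ν : Ordinal.{u}} (h : ν < p.height) : p.enum ν ∈ p.topSet := by
  rw [← p.image_enum]
  exact ⟨ν, h, rfl⟩

theorem enum_rel {ν : Ordinal.{u}} (h : ν < p.height) : p.rel (p.lam, ν) (κ.ord, p.enum ν) :=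
  p.top.choose_spec.choose_spec.2.2.2 ν h

/-- The nodes below the `ν`-th node at level `κ`. -/
theorem rel_enum_iff {x : Node.{u}} {ν : Ordinal.{u}} (hν : ν < p.height) :
    p.rel x (κ.ord, p.enum ν) ↔ p.stem.le x (p.lam, ν) := by
  have h := enum_rel hν
  constructor
  · intro hx
    rcases p.frame.linear hx h with h' | h' | h'
    · exact Or.inl h'
    · exact Or.inr ⟨h', le_rfl⟩
    · have h1 := p.monotone _ _ h'
      have h2 := p.monotone _ _ hx
      rcases p.S_subset x (p.tree.mem _ _ hx).1 with h3 | h3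
      · exact absurd h1 (not_lt.2 h3.1)
      · exact absurd h2 (not_lt.2 h3.1.ge)
  · rintro (rfl | h')
    · exact h
    · exact p.tree.trans _ _ _ h'.1 h

/-- By (M.2) the image of γ is the order of a node at level κ above ⟨λ, γ⟩, and the only such node
is the γ-th one. All maps from level λ to level κ are thus restrictions of a single function. -/
theorem π_enum_self {ν γ : Ordinal.{u}} (hν : ν < p.height) (hγ : γ ≤ ν) :
    p.π (p.lam, ν) (κ.ord, p.enum ν) γ = p.enum γ := by
  have h := enum_rel hν
  rcases hγ.eq_or_lt with rfl | hγ
  · exact (p.M1 _ _ h).2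
  · obtain ⟨h1, -⟩ := p.M2 _ _ h γ hγ
    obtain ⟨μ, hμ, e⟩ := exists_enum_eq (p := p) (p.tree.mem _ _ h1).2
    change p.rel (p.lam, γ) _ at h1
    rw [← e] at h1 ⊢
    rcases (rel_enum_iff hμ).1 h1 with h2 | h2
    · exact congrArg p.enum (Prod.ext_iff.1 h2).2.symm
    · exact absurd (p.stem.monotone h2) (lt_irrefl _)

theorem π_enum {x : Node.{u}} {ν γ : Ordinal.{u}} (hν : ν < p.height)
    (hx : p.stem.le x (p.lam, ν)) (hγ : γ ≤ x.2) :
    p.π x (κ.ord, p.enum ν) γ = p.enum (p.stem.pi x (p.lam, ν) γ) := by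
  rcases hx with rfl | hx
  · rw [Frame.pi_self]
    exact π_enum_self hν hγ
  · have hle : p.π x (p.lam, ν) γ ≤ ν := p.frame.π_le hx.1 hγ
    rw [Frame.pi_of_rel hx, stem_π hx, ← π_enum_self hν hle]
    exact (p.comm _ _ _ hx.1 (enum_rel hν) γ hγ).symm

theorem mem_cases {x : Node.{u}} (hx : x ∈ p.S) :
    x.1 ≤ p.lam ∨ ∃ ν < p.height, x = (κ.ord, p.enum ν) := by
  rcases p.S_subset x hx with h | h
  · exact Or.inl h.1
  · have h' : x.2 ∈ p.topSet := by
      change (κ.ord, x.2) ∈ p.S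
      rw [← h.1]
      exact hx
    obtain ⟨ν, hν, e⟩ := exists_enum_eq h'
    exact Or.inr ⟨ν, hν, Prod.ext h.1 e.symm⟩

theorem level_le_of_rel {x y : Node.{u}} (h : p.rel x y) : x.1 ≤ p.lam := by
  rcases p.mem_cases (p.tree.mem _ _ h).2 with hy | ⟨ν, hν, rfl⟩
  · exact (p.monotone _ _ h).le.trans hy
  · exact Frame.le_level ((rel_enum_iff hν).1 h)

/-- Deleting nodes at level `κ` preserves extension of the conditions that remain included. -/
theorem Extends.of_subset {r s c : MorassCondition κ} (h : r.Extends c) (hl : s.lam = r.lam)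
    (hcs : c.S ⊆ s.S) (hsr : s.S ⊆ r.S) (hlow : ∀ x ∈ r.S, x.1 ≤ r.lam → x ∈ s.S)
    (hrel : ∀ x, ∀ y ∈ s.S, s.rel x y ↔ r.rel x y)
    (hπ : ∀ x y, s.rel x y → ∀ γ ≤ x.2, s.π x y γ = r.π x y γ) : s.Extends c where
  subset := hcs
  inter_eq := by
    refine Set.Subset.antisymm (fun x hx => ⟨hcs hx.1, hx.2⟩) fun x hx => ?_
    rw [h.inter_eq]
    exact ⟨hsr hx.1, hx.2⟩
  rel_iff x hx y hy := (h.rel_iff x hx y hy).trans (hrel x y (hcs hy)).symm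
  π_eq x y hxy γ hγ := by
    have hm := c.tree.mem _ _ hxy
    rw [h.π_eq x y hxy γ hγ, hπ x y ?_ γ hγ]
    rw [hrel x y (hcs hm.2), ← h.rel_iff x hm.1 y hm.2]
    exact hxy
  mangal := by
    refine ⟨hl ▸ h.mangal.1, fun x hx y hy hxy h1 h2 => ?_⟩
    obtain ⟨z, hz, e, hz1, hz2⟩ :=
      h.mangal.2 x (hsr hx) y (hsr hy) ((hrel x y hy).1 hxy) h1 h2
    -- The interpolating node lies at level λ^c, below κ, so it has not been deleted.
    have hzs : z ∈ s.S := hlow z hz (e ▸ h.mangal.1)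
    exact ⟨z, hzs, e, (hrel x z hzs).2 hz1, (hrel z y hy).2 hz2⟩

/-- Below a limit ordinal `α`, the nodes at level `κ` form an initial segment of limit length. -/
theorem exists_cut (p : MorassCondition κ) {α : Ordinal.{u}} (hα : IsSuccLimit α) :
    ∃ ν₀ ≤ p.height, (∀ ν < p.height, ν < ν₀ ↔ p.enum ν < α) ∧ IsSuccLimit ν₀ := by
  have hlow : IsLowerSet {ν | ν < p.height ∧ p.enum ν < α} := fun a b hba ha =>
    ⟨hba.trans_lt ha.1, (p.isTop.sloop.map_le hba ha.1).trans_lt ha.2⟩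
  obtain ⟨ν₀, h1, h2⟩ := exists_eq_Iio_of_isLowerSet hlow (b := p.height)
    fun h => lt_irrefl _ h.1
  have h3 : ∀ ν < p.height, ν < ν₀ ↔ p.enum ν < α := fun ν hν => by
    rw [← Set.mem_Iio, ← h2]
    exact ⟨fun h => h.2, fun h => ⟨hν, h⟩⟩
  refine ⟨ν₀, h1, h3, isSuccLimit_of_add_one_lt ?_ fun ν hν => ?_⟩
  · have h0 := p.isTop.limit.bot_lt
    refine (h3 _ h0).2 ?_
    rw [show p.enum ⊥ = 0 from p.isTop.sloop.map_zero h0]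
    exact hα.bot_lt
  · have h4 : ν + 1 < p.height := p.isTop.limit.succ_lt (hν.trans_le h1)
    rw [h3 _ h4, p.isTop.sloop.map_succ ν h4]
    exact hα.succ_lt ((h3 ν (hν.trans_le h1)).1 hν)

/-- Every condition `r` has a restriction to a limit ordinal `α`. -/
theorem exists_restriction (r : MorassCondition κ) {α : Ordinal.{u}} (hα : IsSuccLimit α) :
    ∃ s : MorassCondition κ, s.lam = r.lam ∧ s.topSet = r.topSet ∩ Set.Iio α ∧
      ∀ c : MorassCondition κ, r.Extends c → c.topSet ⊆ Set.Iio α → s.Extends c := by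
  obtain ⟨ν₀, h1, h2, h3⟩ := r.exists_cut hα
  -- The restriction keeps the whole stem and cuts the enumeration at ν₀, which is a limit because α
  -- is one.
  have ht : r.stem.IsTop ν₀ r.enum := ⟨h3, r.isTop.sloop.mono h1,
    (Set.Iio_subset_Iio h1).trans r.isTop.sub, fun ν hν => r.isTop.lt ν (hν.trans_le h1)⟩
  have hT : (r.stem.cond ht).topSet = r.topSet ∩ Set.Iio α := by
    rw [Stem.topSet_cond]
    ext β
    constructor
    · rintro ⟨ν, hν, rfl⟩
      exact ⟨enum_mem (hν.trans_le h1), (h2 ν (hν.trans_le h1)).1 hν⟩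
    · rintro ⟨hβ, hβα⟩
      obtain ⟨ν, hν, rfl⟩ := exists_enum_eq hβ
      exact ⟨ν, (h2 ν hν).2 hβα, rfl⟩
  have hcases : ∀ y ∈ (r.stem.cond ht).S, y.1 ≤ r.lam ∨ ∃ ν < ν₀, y = (κ.ord, r.enum ν) := by
    rintro y (hy | ⟨hy, ν, hν, e⟩)
    · exact Or.inl hy.2
    · exact Or.inr ⟨ν, hν, Prod.ext hy e.symm⟩
  have hrel : ∀ x, ∀ y ∈ (r.stem.cond ht).S, (r.stem.cond ht).rel x y ↔ r.rel x y := by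
    intro x y hy
    rcases hcases y hy with hl | ⟨ν, hν, rfl⟩
    · rw [Stem.cond_rel_of_le_lam ht hl, stem_rel_iff]
      exact and_iff_left hl
    · rw [Stem.cond_rel_top ht hν, rel_enum_iff (hν.trans_le h1)]
      rfl
  refine ⟨r.stem.cond ht, rfl, hT, fun c hc hcα => hc.of_subset rfl ?_ ?_ ?_ hrel ?_⟩
  · intro x hx
    rcases c.mem_cases hx with hl | ⟨ν, hν, rfl⟩
    · exact Or.inl ⟨hc.subset hx, hl.trans hc.mangal.1⟩
    · have : c.enum ν ∈ (r.stem.cond ht).topSet := by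
        rw [hT]
        exact ⟨hc.subset hx, hcα (enum_mem hν)⟩
      exact this
  · rintro x (hx | ⟨hx, ν, hν, e⟩)
    · exact hx.1
    · have : r.enum ν ∈ r.topSet := enum_mem (lt_of_lt_of_le hν h1)
      rw [show x = (κ.ord, r.enum ν) from Prod.ext hx e.symm]
      exact this
  · exact fun x hx hl => Or.inl ⟨hx, hl⟩
  · intro x y hxy γ hγ
    rcases hcases y ((r.stem.cond ht).tree.mem _ _ hxy).2 with hl | ⟨ν, hν, rfl⟩
    · have h' := (Stem.cond_rel_of_le_lam ht hl).1 hxy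
      rw [Stem.cond_π_of_rel ht h', stem_π h']
    · have h' := (Stem.cond_rel_top ht hν).1 hxy
      rw [Stem.cond_π_top ht hν h' hγ, π_enum (hν.trans_le h1) h' hγ]
      rfl

end MorassCondition

/-! ### Adding levels to a stem -/

/-- Divisibility by ω^ν is inherited by smaller exponents, and ω^ν ≥ ν excludes exponents above ξ.
The bound ξ + 1 keeps the size of each new level below κ. -/
theorem exists_level_eq {ξ : Ordinal.{u}} (hξ : ξ ≠ 0) :
    ∃ θ ≤ ξ + 1, 0 < θ ∧ {ν : Ordinal.{u} | ω ^ ν ∣ ξ} = Set.Iio θ := by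
  have hlow : IsLowerSet {ν : Ordinal.{u} | ω ^ ν ∣ ξ} := fun a b hba ha =>
    (opow_dvd_opow ω hba).trans ha
  obtain ⟨θ, h1, h2⟩ := exists_eq_Iio_of_isLowerSet hlow (b := ξ + 1) fun h =>
    absurd ((right_le_opow _ one_lt_omega0).trans (le_of_dvd hξ h)) (not_le.2 (lt_add_one ξ))
  refine ⟨θ, h1, ?_, h2⟩
  rw [← Set.mem_Iio, ← h2]
  simp

open Classical in
/-- The frame of the nodes `⟨lam + ξ, ν⟩` such that `0 < ξ ≤ ω ^ Θ` and `ω ^ ν` divides `ξ`, with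
identity maps between nodes of equal order. -/
noncomputable def towerFrame (lam Θ : Ordinal.{u}) : Frame.{u} where
  S := {x | lam < x.1 ∧ x.1 ≤ lam + ω ^ Θ ∧ ω ^ x.2 ∣ x.1 - lam}
  rel x y := (lam < x.1 ∧ ω ^ x.2 ∣ x.1 - lam) ∧
    (y.1 ≤ lam + ω ^ Θ ∧ ω ^ y.2 ∣ y.1 - lam) ∧ x.1 < y.1 ∧ x.2 = y.2
  π x y γ := if ((lam < x.1 ∧ ω ^ x.2 ∣ x.1 - lam) ∧
    (y.1 ≤ lam + ω ^ Θ ∧ ω ^ y.2 ∣ y.1 - lam) ∧ x.1 < y.1 ∧ x.2 = y.2) ∧ γ ≤ x.2 then γ else 0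
  mem h := ⟨⟨h.1.1, h.2.2.1.le.trans h.2.1.1, h.1.2⟩, h.1.1.trans h.2.2.1, h.2.1⟩
  trans h h' := ⟨h.1, h'.2.1, h.2.2.1.trans h'.2.2.1, h.2.2.2.trans h'.2.2.2⟩
  linear {x x' y} h h' := by
    rcases lt_trichotomy x.1 x'.1 with hlt | heq | hlt
    · exact Or.inr (Or.inl ⟨h.1, ⟨h'.2.2.1.le.trans h'.2.1.1, h'.1.2⟩, hlt,
        h.2.2.2.trans h'.2.2.2.symm⟩)
    · exact Or.inl (Prod.ext heq (h.2.2.2.trans h'.2.2.2.symm))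
    · exact Or.inr (Or.inr ⟨h'.1, ⟨h.2.2.1.le.trans h.2.1.1, h.1.2⟩, hlt,
        h'.2.2.2.trans h.2.2.2.symm⟩)
  monotone h := h.2.2.1
  π_default _ _ _ h := if_neg h
  comm {x y z} h h' γ hγ := by
    have h'' : γ ≤ y.2 := h.2.2.2 ▸ hγ
    simp only [if_pos (And.intro h hγ)]
    rw [if_pos ⟨h', h''⟩, if_pos ⟨⟨h.1, h'.2.1, h.2.2.1.trans h'.2.2.1,
      h.2.2.2.trans h'.2.2.2⟩, hγ⟩]
  sloop h := (IsSLOOP.id _).congr fun γ hγ => if_pos ⟨h, Order.lt_add_one_iff.1 hγ⟩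
  π_top h := (if_pos ⟨h, le_rfl⟩).trans h.2.2.2
  restrict {x y} h ν hν := by
    have h1 : ω ^ ν ∣ x.1 - lam := (opow_dvd_opow ω hν.le).trans h.1.2
    have h2 : ω ^ ν ∣ y.1 - lam := (opow_dvd_opow ω (hν.le.trans h.2.2.2.le)).trans h.2.1.2
    rw [if_pos ⟨h, hν.le⟩]
    refine ⟨⟨⟨h.1.1, h1⟩, ⟨h.2.1.1, h2⟩, h.2.2.1, rfl⟩, fun γ hγ => ?_⟩
    rw [if_pos ⟨⟨⟨h.1.1, h1⟩, ⟨h.2.1.1, h2⟩, h.2.2.1, rfl⟩, hγ⟩, if_pos ⟨h, hγ.trans hν.le⟩]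
  closed y hy ε hε h0 h := by
    -- A single predecessor below ε puts ε above `lam`; after subtracting `lam`, the claim is that
    -- multiples of a power of ω are closed.
    obtain ⟨_, ⟨x, hx, rfl⟩, -, hxε⟩ := h 0 h0
    have hlt : lam < ε := hx.1.1.trans hxε
    refine ⟨(ε, y.2), ⟨⟨hlt, ?_⟩, hy.2, hε, rfl⟩, rfl⟩
    refine dvd_of_forall_exists_between (opow_ne_zero _ omega0_ne_zero) fun β hβ => ?_
    obtain ⟨_, ⟨x, hx, rfl⟩, h1, h2⟩ := h (lam + β) (Ordinal.lt_sub.1 hβ)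
    exact ⟨x.1 - lam, hx.2.2.2 ▸ hx.1.2, Ordinal.lt_sub.2 h1,
      (Ordinal.sub_lt_of_le hx.1.1.le).2 (by
        rwa [Ordinal.add_sub_cancel_of_le hlt.le])⟩

theorem towerFrame_π {lam Θ : Ordinal.{u}} {x y : Node.{u}} (h : (towerFrame lam Θ).rel x y)
    {γ : Ordinal.{u}} (hγ : γ ≤ x.2) : (towerFrame lam Θ).π x y γ = γ := if_pos ⟨h, hγ⟩

theorem towerFrame_level {lam Θ a : Ordinal.{u}} (h1 : lam < a) (h2 : a ≤ lam + ω ^ Θ) :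
    level (towerFrame lam Θ).S a = {ν | ω ^ ν ∣ a - lam} := by
  ext ν
  exact ⟨fun h => h.2.2, fun h => ⟨h1, h2, h⟩⟩

namespace Stem

/-- Parameters for placing new levels upon a stem: the nodes `⟨lam, ν⟩` with `ν < A` receive
successors of the same order, and the nodes `⟨lam, m + ι⟩` with `ι < τ` receive further successors
of order `A + ι`. -/
structure Splitting (L : Stem κ) (A m τ : Ordinal.{u}) : Prop where
  sub : Set.Iio A ⊆ level L.S L.lam
  add_lt : ∀ ι < τ, m + ι < A
  limit : 0 < τ → IsSuccLimit m ∧ IsSuccLimit A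

variable {L : Stem κ} {A m τ : Ordinal.{u}}

theorem Splitting.lt (h : L.Splitting A m τ) {ι : Ordinal.{u}} (hι : ι < τ) : m < A :=
  lt_of_le_of_lt le_self_add (h.add_lt ι hι)

open Classical in
/-- The map from `⟨lam, ν⟩` into a node of order `η`. -/
noncomputable def splitMap (A m η : Ordinal.{u}) : Ordinal.{u} → Ordinal.{u} :=
  if η < A then fun γ => γ else glue m (fun γ => γ) fun ι => A + ι

theorem splitMap_of_lt {η : Ordinal.{u}} (h : η < A) (γ : Ordinal.{u}) :
    splitMap A m η γ = γ := by
  rw [splitMap, if_pos h]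

theorem splitMap_of_lt_of_le {η γ : Ordinal.{u}} (h : A ≤ η) (hγ : γ < m) :
    splitMap A m η γ = γ := by
  rw [splitMap, if_neg (not_lt.2 h), glue_of_lt hγ]

theorem splitMap_add {η ι : Ordinal.{u}} (h : A ≤ η) : splitMap A m η (m + ι) = A + ι := by
  rw [splitMap, if_neg (not_lt.2 h), glue_add]

/-- The jump from m to A is compatible with SLOOP because m and A are both limits and m < A. -/
theorem Splitting.isSLOOP (h : L.Splitting A m τ) {ι : Ordinal.{u}} (hι : ι < τ) :
    IsSLOOP (m + ι + 1) (splitMap A m (A + ι)) := by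
  have h0 := (zero_le).trans_lt hι
  have hlim := h.limit h0
  rw [splitMap, if_neg (not_lt.2 le_self_add)]
  refine (IsSLOOP.glue (τ := τ) hlim.1 (IsSLOOP.id m) (fun ι _ => (add_assoc _ _ _).symm) ?_
    (fun _ _ h _ => by gcongr) ?_).mono ?_
  · rintro ι - (rfl | hι)
    · rw [add_zero]
      exact hlim.2
    · exact isSuccLimit_add _ hι
  · intro _ γ hγ
    rw [add_zero]
    exact hγ.trans (h.lt h0)
  · exact Order.add_one_le_of_lt (by gcongr)

/-- The new levels placed upon a stem. -/
noncomputable def Splitting.attachment (h : L.Splitting A m τ) (Θ : Ordinal.{u}) :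
    Attachment L.toFrame (towerFrame L.lam Θ) L.lam where
  base y ν := y ∈ (towerFrame L.lam Θ).S ∧
    ((y.2 < A ∧ ν = y.2) ∨ ∃ ι < τ, y.2 = A + ι ∧ ν = m + ι)
  up y := splitMap A m y.2
  le_lam hx := (L.bound hx).1
  lam_lt hy := hy.1
  base_mem := by
    rintro y ν ⟨hy, ⟨h1, rfl⟩ | ⟨ι, hι, -, rfl⟩⟩
    · exact ⟨hy, h.sub h1⟩
    · exact ⟨hy, h.sub (h.add_lt ι hι)⟩
  base_unique := by
    rintro y ν ν' ⟨-, ⟨h1, rfl⟩ | ⟨ι, hι, e, rfl⟩⟩ ⟨-, ⟨h1', rfl⟩ | ⟨ι', hι', e', rfl⟩⟩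
    · rfl
    · exact absurd h1 (not_lt.2 (e' ▸ le_self_add))
    · exact absurd h1' (not_lt.2 (e ▸ le_self_add))
    · rw [add_left_cancel (e.symm.trans e')]
  sloop := by
    rintro y ν ⟨hy, ⟨h1, rfl⟩ | ⟨ι, hι, e, rfl⟩⟩
    · exact (IsSLOOP.id _).congr fun γ _ => splitMap_of_lt h1 γ
    · rw [e]
      exact h.isSLOOP hι
  up_top := by
    rintro y ν ⟨hy, ⟨h1, rfl⟩ | ⟨ι, hι, e, rfl⟩⟩
    · exact splitMap_of_lt h1 _
    · rw [e]
      exact splitMap_add le_self_add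
  restrict := by
    rintro ⟨a, η⟩ ν ⟨hy, ⟨h1, rfl⟩ | ⟨ι, hι, e, rfl⟩⟩ ν' hν'
    · have h2 : ν' < A := hν'.trans h1
      simp only [splitMap_of_lt h1, splitMap_of_lt h2, implies_true, and_true]
      exact ⟨⟨hy.1, hy.2.1, (opow_dvd_opow ω hν'.le).trans hy.2.2⟩, Or.inl h2⟩
    · change η = A + ι at e
      subst e
      rcases lt_or_exists_eq_add ν' m with h2 | ⟨ι', rfl⟩
      · have h3 : ν' < A := h2.trans (h.lt hι)
        simp only [splitMap_of_lt_of_le le_self_add h2]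
        refine ⟨⟨⟨hy.1, hy.2.1, (opow_dvd_opow ω (h3.le.trans le_self_add)).trans hy.2.2⟩,
          Or.inl ⟨h3, trivial⟩⟩, fun γ hγ => ?_⟩
        rw [splitMap_of_lt h3, splitMap_of_lt_of_le le_self_add (hγ.trans_lt h2)]
      · have h3 : ι' < ι := lt_of_add_lt_add_left hν'
        have h4 : A + ι' ≤ A + ι := by gcongr
        simp only [splitMap_add le_self_add]
        refine ⟨⟨⟨hy.1, hy.2.1, (opow_dvd_opow ω h4).trans hy.2.2⟩,
          Or.inr ⟨ι', h3.trans hι, rfl, rfl⟩⟩, fun γ _ => ?_⟩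
        rw [splitMap, splitMap, if_neg (not_lt.2 le_self_add), if_neg (not_lt.2 le_self_add)]
  base_iff {x y ν} hxy := by
    have hm := (towerFrame L.lam Θ).mem hxy
    rw [hxy.2.2.2, and_iff_right hm.1, and_iff_right hm.2]
  comm {x y ν} hxy hb γ hγ := by
    obtain ⟨hx, hb⟩ := hb
    rw [← hxy.2.2.2]
    refine towerFrame_π hxy ?_
    rcases hb with ⟨h1, rfl⟩ | ⟨ι, hι, e, rfl⟩
    · rw [splitMap_of_lt h1]
      exact hγ
    · rw [e]
      refine ((h.isSLOOP hι).map_le hγ (lt_add_one _)).trans ?_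
      rw [splitMap_add le_self_add]

section Extend

variable (h : L.Splitting A m τ) {Θ : Ordinal.{u}}

theorem Splitting.base_self {y : Node.{u}} (hy : y ∈ (towerFrame L.lam Θ).S) (hA : y.2 < A) :
    (h.attachment Θ).base y y.2 := ⟨hy, Or.inl ⟨hA, rfl⟩⟩

theorem Splitting.base_add {y : Node.{u}} {ι : Ordinal.{u}} (hy : y ∈ (towerFrame L.lam Θ).S)
    (hι : ι < τ) (e : y.2 = A + ι) : (h.attachment Θ).base y (m + ι) :=
  ⟨hy, Or.inr ⟨ι, hι, e, rfl⟩⟩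

/-- If o(y) is not the largest order at its level, then ω^(o(y) + 1) divides the distance to `lam`,
and nodes of order o(y) accumulate at that level. This is (M.4). -/
theorem Splitting.unboundedIn {y : Node.{u}} (hy : y ∈ (towerFrame L.lam Θ).S)
    (hne : level (h.attachment Θ).stack.S y.1 ≠ Set.Iio (y.2 + 1)) :
    UnboundedIn (predLevels (h.attachment Θ).stack.rel y) y.1 := by
  have hdvd : ω ^ (y.2 + 1) ∣ y.1 - L.lam := by
    rw [Attachment.stack_level_of_lt hy.1, towerFrame_level hy.1 hy.2.1] at hne
    by_contra hnd
    refine hne (Set.Subset.antisymm (fun ν hν => ?_) fun ν hν => ?_)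
    · refine not_le.1 fun hle => hnd ((opow_dvd_opow ω hle).trans hν)
    · exact (opow_dvd_opow ω (Order.lt_add_one_iff.1 hν)).trans hy.2.2
  intro β hβ
  have h1 : max β L.lam < y.1 := max_lt hβ hy.1
  have h2 : max β L.lam - L.lam < y.1 - L.lam := by
    rw [Ordinal.lt_sub, Ordinal.add_sub_cancel_of_le (le_max_right _ _)]
    exact h1
  obtain ⟨ζ, hζ1, hζ2, hζ3⟩ := exists_dvd_between hdvd h2
  have h3 : max β L.lam < L.lam + ζ := by
    conv_lhs => rw [← Ordinal.add_sub_cancel_of_le (le_max_right β L.lam)]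
    gcongr
  refine ⟨L.lam + ζ, ⟨(L.lam + ζ, y.2), Or.inr (Or.inl ⟨⟨?_, ?_⟩, hy.2, ?_, rfl⟩), rfl⟩,
    (le_max_left _ _).trans_lt h3⟩
  · exact (le_max_right _ _).trans_lt h3
  · change ω ^ y.2 ∣ L.lam + ζ - L.lam
    rwa [Ordinal.add_sub_cancel]
  · exact Ordinal.lt_sub.1 hζ3

/-- Unboundedness provides a predecessor above level `lam`; its map to y is the identity and already
covers o(y). This is (M.5). -/
theorem Splitting.iio_eq {y : Node.{u}} (hy : y ∈ (towerFrame L.lam Θ).S)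
    (hu : UnboundedIn (predLevels (h.attachment Θ).stack.rel y) y.1) :
    Set.Iio y.2 = {μ | ∃ x, (h.attachment Θ).stack.rel x y ∧
      μ ∈ (h.attachment Θ).stack.π x y '' Set.Iio x.2} := by
  ext μ
  constructor
  · intro hμ
    obtain ⟨_, ⟨x, hx, rfl⟩, h1⟩ := hu _ hy.1
    have hx' := (Attachment.stack_rel_of_lam_lt h1).1 hx
    refine ⟨x, hx, μ, hx'.2.2.2 ▸ hμ, ?_⟩
    change (h.attachment Θ).map x y μ = μ
    rw [(h.attachment Θ).map_upper hx', towerFrame_π hx']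
    rw [hx'.2.2.2]
    exact (Set.mem_Iio.1 hμ).le
  · rintro ⟨x, hx, γ, hγ, rfl⟩
    exact (h.attachment Θ).stack.π_lt hx hγ

/-- Immediate successors among the new nodes arise from a new node or from the level `lam`. -/
theorem Splitting.immSucc_cases {x y : Node.{u}} (hy : L.lam < y.1)
    (hxy : ImmSucc (h.attachment Θ).stack.rel x y) :
    (towerFrame L.lam Θ).rel x y ∨ ∃ ν, x = (L.lam, ν) ∧ (h.attachment Θ).base y ν := by
  rcases hxy.1 with h1 | h1 | ⟨ν, h1, rfl | h2⟩
  · exact absurd hy (not_lt.2 ((h.attachment Θ).level_of_rel_lower h1).2)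
  · exact Or.inl h1
  · exact Or.inr ⟨ν, rfl, h1⟩
  · exact absurd ⟨Or.inl h2, Or.inr (Or.inr ⟨ν, h1, Or.inl rfl⟩)⟩ (hxy.2 (L.lam, ν))

theorem csSup_image_of_forall_eq {s : Ordinal.{u} → Ordinal.{u}} {o : Ordinal.{u}}
    (ho : IsSuccLimit o) (hs : ∀ γ < o, s γ = γ) : sSup (s '' Set.Iio o) = o := by
  have : s '' Set.Iio o = Set.Iio o := by
    ext γ
    constructor
    · rintro ⟨δ, hδ, rfl⟩
      rw [hs δ hδ]
      exact hδ
    · exact fun hγ => ⟨γ, hγ, hs γ hγ⟩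
  rw [this]
  exact ho.isSuccPrelimit.sSup_Iio

/-- The values A + κ with κ < ι are cofinal in A + ι. At ι = 0 continuity may fail: for limit m the
supremum there is m. -/
theorem csSup_image_splitMap (hmA : m ≤ A) {ι : Ordinal.{u}} (hι : IsSuccLimit ι) :
    sSup (splitMap A m (A + ι) '' Set.Iio (m + ι)) = A + ι := by
  have hmem : ∀ κ < ι, A + κ ∈ splitMap A m (A + ι) '' Set.Iio (m + ι) := fun κ hκ =>
    ⟨m + κ, by simpa using hκ, splitMap_add le_self_add⟩
  have hle : A + ι ∈ upperBounds (splitMap A m (A + ι) '' Set.Iio (m + ι)) := by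
    rintro _ ⟨γ, hγ, rfl⟩
    rcases lt_add_cases (Set.mem_Iio.1 hγ) with h | ⟨κ, hκ, rfl⟩
    · rw [splitMap_of_lt_of_le le_self_add h]
      exact h.le.trans (hmA.trans le_self_add)
    · rw [splitMap_add le_self_add]
      gcongr
  refine le_antisymm (csSup_le' hle) (le_of_forall_lt fun μ hμ => ?_)
  rcases lt_add_cases hμ with h | ⟨κ, hκ, rfl⟩
  · have := hmem 0 hι.bot_lt
    rw [add_zero] at this
    exact h.trans_le (le_csSup ⟨_, hle⟩ this)
  · have h1 : κ + 1 < ι := hι.succ_lt hκ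
    refine lt_of_lt_of_le ?_ (le_csSup ⟨_, hle⟩ (hmem _ h1))
    rw [← add_assoc]
    exact lt_add_one _

/-- For (M.6), all immediate edges above `lam` are continuous at a limit o(x), so y itself serves,
except the edges from ⟨lam, m⟩ to a node of order A. There the supremum is m, and the node of order
m at the same level lies above ⟨lam, m⟩ by the identity. -/
theorem Splitting.map_sSup {x y : Node.{u}} (hy : L.lam < y.1)
    (hxy : ImmSucc (h.attachment Θ).stack.rel x y) (hx : IsSuccLimit x.2) :
    (h.attachment Θ).stack.rel x (y.1, sSup ((h.attachment Θ).stack.π x y '' Set.Iio x.2)) ∧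
      ∀ γ < x.2, (h.attachment Θ).stack.π x
        (y.1, sSup ((h.attachment Θ).stack.π x y '' Set.Iio x.2)) γ =
          (h.attachment Θ).stack.π x y γ := by
  have of_eq : sSup ((h.attachment Θ).stack.π x y '' Set.Iio x.2) = y.2 →
      (h.attachment Θ).stack.rel x (y.1, sSup ((h.attachment Θ).stack.π x y '' Set.Iio x.2)) ∧
      ∀ γ < x.2, (h.attachment Θ).stack.π x
        (y.1, sSup ((h.attachment Θ).stack.π x y '' Set.Iio x.2)) γ =
          (h.attachment Θ).stack.π x y γ := by
    intro e
    rw [e]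
    exact ⟨hxy.1, fun _ _ => rfl⟩
  rcases h.immSucc_cases hy hxy with h1 | ⟨ν, rfl, hb⟩
  · refine of_eq ?_
    rw [← h1.2.2.2]
    refine csSup_image_of_forall_eq hx fun γ hγ => ?_
    change (h.attachment Θ).map x y γ = γ
    rw [(h.attachment Θ).map_upper h1, towerFrame_π h1 hγ.le]
  · have hmap : ∀ γ ≤ ν, (h.attachment Θ).stack.π (L.lam, ν) y γ = splitMap A m y.2 γ := by
      intro γ hγ
      change (h.attachment Θ).map (L.lam, ν) y γ = splitMap A m y.2 γ
      rw [(h.attachment Θ).map_mid hb (Or.inl rfl) hγ, Frame.pi_self]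
      rfl
    have himg : (h.attachment Θ).stack.π (L.lam, ν) y '' Set.Iio ν =
        splitMap A m y.2 '' Set.Iio ν := Set.image_congr fun γ hγ => hmap γ (le_of_lt hγ)
    change IsSuccLimit ν at hx
    obtain ⟨hyU, ⟨h1, rfl⟩ | ⟨ι, hι, e, rfl⟩⟩ := hb
    · refine of_eq ?_
      change sSup ((h.attachment Θ).stack.π (L.lam, y.2) y '' Set.Iio y.2) = y.2
      rw [himg]
      exact csSup_image_of_forall_eq hx fun γ _ => splitMap_of_lt h1 γ
    · rcases eq_or_ne ι 0 with rfl | hne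
      · simp only [add_zero] at hx himg hmap e ⊢
        have hlow : ∀ γ < m, splitMap A m y.2 γ = γ := fun γ hγ =>
          splitMap_of_lt_of_le e.ge hγ
        have hmA : m < A := h.lt hι
        have hsup : sSup ((h.attachment Θ).stack.π (L.lam, m) y '' Set.Iio m) = m := by
          rw [himg]
          exact csSup_image_of_forall_eq hx hlow
        change (h.attachment Θ).stack.rel (L.lam, m)
          (y.1, sSup ((h.attachment Θ).stack.π (L.lam, m) y '' Set.Iio m)) ∧ ∀ γ < m, _
        rw [hsup]
        have hb : (h.attachment Θ).base (y.1, m) m := h.base_self (y := (y.1, m))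
          ⟨hyU.1, hyU.2.1, (opow_dvd_opow ω (hmA.le.trans e.ge)).trans hyU.2.2⟩ hmA
        refine ⟨Or.inr (Or.inr ⟨m, hb, Or.inl rfl⟩), fun γ hγ => ?_⟩
        rw [hmap γ hγ.le, hlow γ hγ]
        change (h.attachment Θ).map (L.lam, m) (y.1, m) γ = γ
        rw [(h.attachment Θ).map_mid hb (Or.inl rfl) hγ.le, Frame.pi_self]
        exact splitMap_of_lt hmA γ
      · refine of_eq ?_
        change sSup ((h.attachment Θ).stack.π (L.lam, m + ι) y '' Set.Iio (m + ι)) = y.2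
        rw [himg, e]
        exact csSup_image_splitMap (h.lt hι).le (isSuccLimit_of_add hx hne)

/-- For (M.7): an immediate predecessor has level at least `lam`, so a lies among the new levels.
Predecessors at level a keep their order there, and these orders are cofinal in the limit o(y).
Hence ω^μ divides a - lam for all μ < o(y), and so does ω^o(y). -/
theorem Splitting.exists_rel {x y : Node.{u}} (hy : L.lam < y.1)
    (hxy : ImmSucc (h.attachment Θ).stack.rel x y) {a : Ordinal.{u}} (hxa : x.1 < a)
    (hay : a < y.1) (hx : IsSuccLimit x.2)
    (hsup : y.2 = sSup ((h.attachment Θ).stack.π x y '' Set.Iio x.2))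
    (hν : ∀ ν < x.2, ∃ γ, (h.attachment Θ).stack.rel (a, γ)
      (y.1, (h.attachment Θ).stack.π x y ν)) :
    ∃ γ, (h.attachment Θ).stack.rel (a, γ) y := by
  have hla : L.lam < a := by
    rcases h.immSucc_cases hy hxy with h1 | ⟨ν, rfl, -⟩
    · exact h1.1.1.trans hxa
    · exact hxa
  have hyU : y ∈ (towerFrame L.lam Θ).S := by
    rcases ((h.attachment Θ).stack.mem hxy.1).2 with h1 | h1
    · exact absurd hy (not_lt.2 (L.bound h1).1)
    · exact h1
  have hlim : IsSuccLimit y.2 := by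
    have := ((h.attachment Θ).stack.sloop hxy.1).map_limit x.2 (lt_add_one _) hx
    rwa [(h.attachment Θ).stack.π_top hxy.1] at this
  refine ⟨y.2, Or.inr (Or.inl ⟨⟨hla, opow_dvd_of_forall_lt hlim fun μ hμ => ?_⟩, hyU.2, hay, rfl⟩)⟩
  rw [hsup] at hμ
  obtain ⟨_, ⟨ν, hν', rfl⟩, hlt⟩ := exists_lt_of_lt_csSup
    (Set.Nonempty.image _ ⟨0, hx.bot_lt⟩) hμ
  obtain ⟨γ, hγ⟩ := hν ν hν'
  have hγ' := (Attachment.stack_rel_of_lam_lt (by exact hla)).1 hγ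
  have e : γ = (h.attachment Θ).stack.π x y ν := hγ'.2.2.2
  have hd : ω ^ γ ∣ a - L.lam := hγ'.1.2
  exact (opow_dvd_opow ω (e ▸ hlt.le)).trans hd

/-- A stem with new levels. -/
noncomputable def Splitting.extend (hκ : Cardinal.aleph0 ≤ κ) (hΘ : L.lam + ω ^ Θ < κ.ord) :
    Stem κ where
  toFrame := (h.attachment Θ).stack
  lam := L.lam + ω ^ Θ
  lam_lt := hΘ
  bound {x} hx := by
    rcases hx with hx | hx
    · exact ⟨(L.bound hx).1.trans le_self_add, (L.bound hx).2⟩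
    · refine ⟨hx.2.1, lt_of_le_of_lt ?_ hΘ⟩
      -- Since ν ≤ ω^ν, the order of a new node is bounded by its level.
      have hne : x.1 - L.lam ≠ 0 := by
        rw [Ordinal.sub_ne_zero_iff_lt]
        exact hx.1
      calc x.2 ≤ ω ^ x.2 := right_le_opow _ one_lt_omega0
        _ ≤ x.1 - L.lam := le_of_dvd hne hx.2.2
        _ ≤ x.1 := Ordinal.sub_le_self _ _
        _ ≤ _ := hx.2.1
  leftAligned a ha := by
    rcases le_or_gt a L.lam with hl | hl
    · rw [Attachment.stack_level_of_le hl]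
      exact L.leftAligned a hl
    · have hne : a - L.lam ≠ 0 := by
        rw [Ordinal.sub_ne_zero_iff_lt]
        exact hl
      obtain ⟨θ, h1, h2, h3⟩ := exists_level_eq hne
      rw [Attachment.stack_level_of_lt hl, towerFrame_level hl ha]
      refine ⟨θ, h2, h1.trans_lt ?_, h3⟩
      exact (Cardinal.isSuccLimit_ord hκ).succ_lt
        ((Ordinal.sub_le_self _ _).trans_lt (ha.trans_lt hΘ))
  M4 y hy hl := by
    rcases le_or_gt y.1 L.lam with hle | hlt
    · exact L.stack_M4 (h.attachment Θ) y hy hle hl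
    · rcases hy with hy | hy
      · exact absurd hlt (not_lt.2 (L.bound hy).1)
      · exact h.unboundedIn hy hl
  M5 y hy hl := by
    rcases le_or_gt y.1 L.lam with hle | hlt
    · exact L.stack_M5 (h.attachment Θ) y hy hle hl
    · rcases hy with hy | hy
      · exact absurd hlt (not_lt.2 (L.bound hy).1)
      · exact h.iio_eq hy hl
  M6 x y hxy hx := by
    rcases le_or_gt y.1 L.lam with hle | hlt
    · exact L.stack_M6 (h.attachment Θ) x y hxy hle hx
    · exact h.map_sSup hlt hxy hx
  M7 x y hxy a hxa hay hx hsup hν := by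
    rcases le_or_gt y.1 L.lam with hle | hlt
    · exact L.stack_M7 (h.attachment Θ) x y hxy hle a hxa hay hx hsup hν
    · exact h.exists_rel hlt hxy hxa hay hx hsup hν

end Extend

end Stem

/-! ### Closure properties of κ, cofinality and enumerations -/

theorem add_lt_ord {a b : Ordinal.{u}} (hκ : Cardinal.aleph0 ≤ κ) (ha : a < κ.ord)
    (hb : b < κ.ord) : a + b < κ.ord := by
  rw [Cardinal.lt_ord] at *
  rw [card_add]
  exact Cardinal.add_lt_of_lt hκ ha hb

theorem omega0_opow_lt_ord {a : Ordinal.{u}} (hκ : Cardinal.aleph0 < κ) (ha : a < κ.ord) :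
    ω ^ a < κ.ord := by
  rw [Cardinal.lt_ord] at *
  refine (card_opow_le _ _).trans_lt (max_lt hκ (max_lt ?_ ha))
  rwa [card_omega0]

/-- A short sequence below an ordinal of large cofinality is bounded. -/
theorem exists_bound_of_card_lt_cof {α o : Ordinal.{u}} (f : Ordinal.{u} → Ordinal.{u})
    (ho : o.card < α.cof) (hf : ∀ ν < o, f ν < α) : ∃ σ < α, ∀ ν < o, f ν < σ := by
  refine ⟨⨆ i : o.ToType, f (ToType.mk.symm i) + 1, iSup_add_one_lt_of_lt_cof (by simpa)
    fun i => hf _ (ToType.mk.symm i).2, fun ν hν => ?_⟩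
  refine (lt_add_one _).trans_le ?_
  have := Ordinal.le_iSup (fun i : o.ToType => f (ToType.mk.symm i) + 1) (ToType.mk ⟨ν, hν⟩)
  simpa using this

/-- The tail of α beyond σ has the same cofinality as α, hence order type at least κ. -/
theorem add_lt_of_lt_ord_of_le_cof {α σ τ : Ordinal.{u}} (hα : κ ≤ α.cof) (hσ : σ < α)
    (hτ : τ < κ.ord) : σ + τ < α := by
  obtain ⟨ρ, rfl⟩ : ∃ ρ, α = σ + ρ := ⟨_, (Ordinal.add_sub_cancel_of_le hσ.le).symm⟩
  have hρ : ρ ≠ 0 := by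
    rintro rfl
    simp at hσ
  rw [cof_add σ hρ] at hα
  have : τ < ρ := by
    refine hτ.trans_le ?_
    rw [Cardinal.ord_le]
    exact hα.trans (cof_le_card ρ)
  gcongr

theorem IsSLOOP.isSuccLimit_of_map {α γ : Ordinal.{u}} {g : Ordinal.{u} → Ordinal.{u}}
    (hg : IsSLOOP α g) (hγ : γ < α) (h : IsSuccLimit (g γ)) : IsSuccLimit γ := by
  rcases zero_or_succ_or_isSuccLimit γ with rfl | ⟨μ, rfl⟩ | hl
  · rw [hg.map_zero hγ] at h
    exact absurd h.bot_lt (lt_irrefl _)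
  · have e : g (Order.succ μ) = g μ + 1 := hg.map_succ μ hγ
    rw [e] at h
    exact absurd h (not_isSuccLimit_succ _)
  · exact hl

/-- Every bounded set of ordinals has an increasing enumeration. -/
theorem exists_enumeration {S : Set Ordinal.{u}} {b : Ordinal.{u}} (hS : ∀ β ∈ S, β < b) :
    ∃ (ot : Ordinal.{u}) (f : Ordinal.{u} → Ordinal.{u}),
      StrictMonoOn f (Set.Iio ot) ∧ f '' Set.Iio ot = S := by
  -- Adding all ordinals from b on makes the set unbounded, so `enumOrd` applies; S is enumerated by
  -- the indices before that of b.
  have hT : ¬ BddAbove (S ∪ Set.Ici b) := by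
    rw [not_bddAbove_iff]
    exact fun c => ⟨max b (c + 1), Or.inr (Set.mem_Ici.2 (le_max_left _ _)),
      (lt_add_one c).trans_le (le_max_right _ _)⟩
  obtain ⟨ot, hot⟩ := enumOrd_surjective hT (b := b) (Or.inr Set.self_mem_Ici)
  refine ⟨ot, enumOrd (S ∪ Set.Ici b), (enumOrd_strictMono hT).strictMonoOn _, ?_⟩
  ext β
  constructor
  · rintro ⟨ν, hν, rfl⟩
    rcases enumOrd_mem hT ν with h | h
    · exact h
    · have := enumOrd_strictMono hT hν
      rw [hot] at this
      exact absurd this (not_lt.2 h)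
  · intro hβ
    obtain ⟨ν, rfl⟩ := enumOrd_surjective hT (b := β) (Or.inl hβ)
    refine ⟨ν, ?_, rfl⟩
    exact (enumOrd_lt_enumOrd hT).1 ((hS _ hβ).trans_eq hot.symm)

namespace Stem

variable {L : Stem κ} {A m τ Θ : Ordinal.{u}}

/-- The last level has distance ω^Θ from the old one precisely so that every ω^ν with ν < Θ divides
it, leaving room for a set of order type Θ at level κ. -/
theorem Splitting.Iio_subset_level (h : L.Splitting A m τ) (hκ : Cardinal.aleph0 ≤ κ)
    (hΘ : L.lam + ω ^ Θ < κ.ord) :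
    Set.Iio Θ ⊆ level (h.extend hκ hΘ).S (h.extend hκ hΘ).lam := by
  intro ν hν
  refine Or.inr ⟨lt_add_of_pos_right _ (opow_pos _ omega0_pos), le_rfl, ?_⟩
  change ω ^ ν ∣ L.lam + ω ^ Θ - L.lam
  rw [Ordinal.add_sub_cancel]
  exact opow_dvd_opow ω (le_of_lt hν)

theorem Splitting.lam_lt_extend (h : L.Splitting A m τ) (hκ : Cardinal.aleph0 ≤ κ)
    (hΘ : L.lam + ω ^ Θ < κ.ord) : L.lam < (h.extend hκ hΘ).lam :=
  lt_add_of_pos_right _ (opow_pos _ omega0_pos)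

theorem Splitting.extend_le_iff (h : L.Splitting A m τ) (hκ : Cardinal.aleph0 ≤ κ)
    (hΘ : L.lam + ω ^ Θ < κ.ord) {x y : Node.{u}} {ν : Ordinal.{u}} (hx : x.1 ≤ L.lam)
    (hb : (h.attachment Θ).base y ν) : (h.extend hκ hΘ).le x y ↔ L.le x (L.lam, ν) := by
  have hy : L.lam < y.1 := (h.attachment Θ).lam_lt ((h.attachment Θ).base_mem hb).1
  constructor
  · rintro (rfl | hxy)
    · exact absurd hy (not_lt.2 hx)
    · obtain ⟨ν', h1, h2⟩ := (Attachment.stack_rel_of_lt_lam hx hy).1 hxy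
      rwa [(h.attachment Θ).base_unique hb h1]
  · exact fun h' => Or.inr (Or.inr (Or.inr ⟨ν, hb, h'⟩))

theorem Splitting.extend_pi (h : L.Splitting A m τ) (hκ : Cardinal.aleph0 ≤ κ)
    (hΘ : L.lam + ω ^ Θ < κ.ord) {x y : Node.{u}} {ν γ : Ordinal.{u}}
    (hb : (h.attachment Θ).base y ν) (hx : L.le x (L.lam, ν)) (hγ : γ ≤ x.2) :
    (h.extend hκ hΘ).pi x y γ = splitMap A m y.2 (L.pi x (L.lam, ν) γ) := by
  have hr : (h.extend hκ hΘ).rel x y := Or.inr (Or.inr ⟨ν, hb, hx⟩)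
  rw [Frame.pi_of_rel hr]
  exact (h.attachment Θ).map_mid hb hx hγ

end Stem

/-! ### Extending a condition by new levels -/

namespace MorassCondition

theorem Extends.mem_of_le_lam {r p : MorassCondition κ} (h : r.Extends p) {x : Node.{u}}
    (hx : x ∈ r.S) (hl : x.1 ≤ p.lam) : x ∈ p.S :=
  (h.inter_eq.symm.subset ⟨hx, hl, r.lt_ord_of_le_lam hx (hl.trans h.mangal.1)⟩).1

theorem Extends.rel {r p : MorassCondition κ} (h : r.Extends p) {x y : Node.{u}}
    (hxy : p.rel x y) : r.rel x y :=
  (h.rel_iff _ (p.tree.mem _ _ hxy).1 _ (p.tree.mem _ _ hxy).2).1 hxy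

theorem height_lt_ord (p : MorassCondition κ) : p.height < κ.ord := by
  obtain ⟨θ, -, h1, h2⟩ := p.stem.leftAligned p.lam le_rfl
  have := p.isTop.sub
  rw [stem_lam, h2, Set.Iio_subset_Iio_iff] at this
  exact this.trans_lt h1

/-- A condition is extended by placing new levels upon its stem and adding nodes at level `κ`. -/
theorem extends_of_splitting {p : MorassCondition κ} {m τ Θ ot : Ordinal.{u}}
    {f : Ordinal.{u} → Ordinal.{u}} (h : p.stem.Splitting p.height m τ)
    (hκ : Cardinal.aleph0 ≤ κ) (hΘ : p.stem.lam + ω ^ Θ < κ.ord)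
    (ht : (h.extend hκ hΘ).IsTop ot f) (hot : p.height ≤ ot)
    (hf : ∀ ν < p.height, f ν = p.enum ν) :
    ((h.extend hκ hΘ).cond ht).Extends p := by
  have hlam := h.lam_lt_extend hκ hΘ
  -- Orders below the height of p continue the old nodes of the same order, so the old edges to
  -- level κ and their maps survive.
  have hbase : ∀ ν < p.height, (h.attachment Θ).base ((h.extend hκ hΘ).lam, ν) ν := by
    intro ν hν
    refine h.base_self (y := ((h.extend hκ hΘ).lam, ν)) ?_ hν
    rcases ht.sub (hν.trans_le hot : ν < ot) with h1 | h1
    · exact absurd hlam (not_lt.2 (p.stem.bound h1).1)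
    · exact h1
  have hlow : ∀ {x y : Node.{u}}, y.1 ≤ p.lam →
      (((h.extend hκ hΘ).cond ht).rel x y ↔ p.rel x y) := by
    intro x y hy
    rw [Stem.cond_rel_of_le_lam ht (le_trans hy hlam.le)]
    refine (Attachment.stack_rel_of_le_lam hy).trans ?_
    rw [stem_rel_iff]
    exact and_iff_left hy
  have htop : ∀ {x : Node.{u}} {ν : Ordinal.{u}}, x.1 ≤ p.lam → ν < p.height →
      (((h.extend hκ hΘ).cond ht).rel x (κ.ord, p.enum ν) ↔ p.rel x (κ.ord, p.enum ν)) := by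
    intro x ν hx hν
    rw [← hf ν hν, Stem.cond_rel_top ht (hν.trans_le hot),
      h.extend_le_iff hκ hΘ hx (hbase ν hν), hf ν hν, rel_enum_iff hν]
    rfl
  refine ⟨?_, ?_, ?_, ?_, ?_⟩
  · intro x hx
    rcases p.mem_cases hx with hl | ⟨ν, hν, rfl⟩
    · exact Or.inl (Or.inl ⟨hx, hl⟩)
    · exact Or.inr ⟨rfl, ν, hν.trans_le hot, hf ν hν⟩
  · ext x
    constructor
    · rintro ⟨hx, hl⟩
      exact ⟨Or.inl (Or.inl ⟨hx, hl.1⟩), hl⟩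
    · rintro ⟨(hx | hx) | hx, hl⟩
      · exact ⟨hx.1, hl⟩
      · exact absurd hl.1 (not_le.2 hx.1)
      · exact absurd hl.1 (not_le.2 (hx.1 ▸ p.lam_lt))
  · intro x hx y hy
    rcases p.mem_cases hy with hl | ⟨ν, hν, rfl⟩
    · exact (hlow hl).symm
    · rcases p.mem_cases hx with hx | ⟨μ, -, rfl⟩
      · exact (htop hx hν).symm
      · exact ⟨fun h' => absurd (p.monotone _ _ h') (lt_irrefl _),
          fun h' => absurd (MorassCondition.monotone _ _ _ h') (lt_irrefl _)⟩
  · intro x y hxy γ hγ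
    rcases p.mem_cases (p.tree.mem _ _ hxy).2 with hl | ⟨ν, hν, rfl⟩
    · have h1 : p.stem.rel x y := ⟨hxy, hl⟩
      have h2 : (h.extend hκ hΘ).rel x y := Or.inl h1
      rw [Stem.cond_π_of_rel ht h2, ← stem_π h1]
      exact (congrFun (Stem.stack_π _ _ h1) γ).symm
    · have h1 := (rel_enum_iff hν).1 hxy
      have hx := p.level_le_of_rel hxy
      have h2 := (h.extend_le_iff hκ hΘ hx (hbase ν hν)).2 h1
      have h3 := Stem.cond_π_top ht (hν.trans_le hot) h2 hγ
      have h4 : p.stem.pi x (p.stem.lam, ν) γ ≤ ν := Frame.pi_le h1 hγ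
      rw [hf ν hν, h.extend_pi hκ hΘ (hbase ν hν) h1 hγ, Stem.splitMap_of_lt hν,
        hf _ (h4.trans_lt hν)] at h3
      rw [h3, π_enum hν h1 hγ]
      rfl
  · refine ⟨hlam.le, ?_⟩
    -- Edges crossing λ^p pass through a base node at that level, which makes λ^p a mangal of the
    -- extension.
    have key : ∀ x y, (h.extend hκ hΘ).rel x y → x.1 < p.lam → p.lam < y.1 →
        ∃ z ∈ ((h.extend hκ hΘ).cond ht).S, z.1 = p.lam ∧
          ((h.extend hκ hΘ).cond ht).rel x z ∧ ((h.extend hκ hΘ).cond ht).rel z y := by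
      intro x y hxy hx hy
      obtain ⟨ν, -, h2, h3⟩ := Attachment.stack_factors hxy hx hy
      exact ⟨(p.lam, ν), Or.inl ((h.extend hκ hΘ).mem h3).1, rfl, Or.inl (Or.inl h2), Or.inl h3⟩
    rintro x - y - hxy hx hy
    rcases hxy with hxy | hxy | ⟨ν, h1, h2⟩
    · exact key x y hxy hx hy
    · exact hxy.elim
    · rcases h2 with rfl | h2
      · exact absurd hx (not_lt.2 hlam.le)
      · obtain ⟨z, h3, h4, h5, h6⟩ := key x _ h2 hx hlam
        exact ⟨z, h3, h4, h5, ((h.extend hκ hΘ).cond ht).tree.trans _ _ _ h6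
          (Or.inr (Or.inr ⟨ν, h1, Or.inl rfl⟩))⟩

end MorassCondition

/-! ### Reductions for large cofinality -/

open MorassCondition

/-- The reduction p has the stem of q, with the part of S^q from α on replaced by consecutive
ordinals below α. Consecutiveness lets the block survive intact in every extension, so that it can
later be copied to the original tail. -/
theorem exists_reduction (hκ : Cardinal.aleph0 < κ) {α : Ordinal.{u}} (hα : IsSuccLimit α)
    (hακ : α ≤ (Order.succ κ).ord) (hcof : κ ≤ α.cof) (q : MorassCondition κ) :
    ∃ p : MorassCondition κ, p.topSet ⊆ Set.Iio α ∧ ∀ p' : MorassCondition κ, p'.Extends p →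
      p'.topSet ⊆ Set.Iio α → ∃ r : MorassCondition κ, r.Extends p' ∧ r.Extends q := by
  obtain ⟨ν₀, hle, hcut, hν₀⟩ := q.exists_cut hα
  rcases hle.eq_or_lt with rfl | hlt
  · refine ⟨q, fun β hβ => ?_, fun p' hp' _ => ⟨p', Extends.refl p', hp'⟩⟩
    obtain ⟨ν, hν, rfl⟩ := exists_enum_eq hβ
    exact (hcut ν hν).1 hν
  obtain ⟨τ, hτ⟩ : ∃ τ, q.height = ν₀ + τ := ⟨_, (Ordinal.add_sub_cancel_of_le hle).symm⟩
  have hτ0 : τ ≠ 0 := by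
    rintro rfl
    rw [add_zero] at hτ
    exact absurd hτ hlt.ne'
  have hτlim : IsSuccLimit τ := isSuccLimit_of_add (hτ ▸ q.isTop.limit) hτ0
  have hτκ : τ < κ.ord := lt_of_le_of_lt (hτ ▸ le_add_self) q.height_lt_ord
  -- Since ν₀ < κ ≤ cf(α), the elements of S^q below α are bounded below α.
  obtain ⟨σ₀, hσ₀, hσ₀b⟩ := exists_bound_of_card_lt_cof q.enum
    (lt_of_lt_of_le (Cardinal.lt_ord.1 (hlt.trans q.height_lt_ord)) hcof)
    fun ν hν => (hcut ν (hν.trans hlt)).1 hν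
  obtain ⟨σ, hσlim, hσb, hστ⟩ : ∃ σ, IsSuccLimit σ ∧ (∀ ν < ν₀, q.enum ν < σ) ∧ σ + τ < α := by
    -- Adding ω makes σ a limit, as required of the value at the limit index ν₀.
    refine ⟨σ₀ + ω, isSuccLimit_add _ isSuccLimit_omega0,
      fun ν hν => (hσ₀b ν hν).trans_le le_self_add, ?_⟩
    rw [add_assoc]
    refine add_lt_of_lt_ord_of_le_cof hcof hσ₀ (add_lt_ord hκ.le ?_ hτκ)
    rwa [Cardinal.lt_ord, card_omega0]
  have hν₀ι : ∀ ι < τ, ν₀ + ι < q.height := fun ι hι => by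
    rw [hτ]
    gcongr
  have hpα : ∀ ν < q.height, glue ν₀ q.enum (fun ι => σ + ι) ν < α := by
    intro ν hν
    rw [hτ] at hν
    rcases lt_add_cases hν with h | ⟨ι, hι, rfl⟩
    · rw [glue_of_lt h]
      exact (hσb ν h).trans (le_self_add.trans_lt hστ)
    · rw [glue_add]
      exact lt_trans (by gcongr) hστ
  have hp : q.stem.IsTop q.height (glue ν₀ q.enum fun ι => σ + ι) := by
    refine ⟨q.isTop.limit, ?_, q.isTop.sub, fun ν hν => (hpα ν hν).trans_le hακ⟩
    rw [hτ]
    refine IsSLOOP.glue hν₀ (q.isTop.sloop.mono hle) (fun ι _ => (add_assoc _ _ _).symm) ?_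
      (fun _ _ h _ => by gcongr) fun _ γ hγ => ?_
    · rintro ι - (rfl | hι)
      · rwa [add_zero]
      · exact isSuccLimit_add _ hι
    · rw [add_zero]
      exact hσb γ hγ
  refine ⟨q.stem.cond hp, ?_, fun p' hp' hp'α => ?_⟩
  · rw [Stem.topSet_cond]
    rintro _ ⟨ν, hν, rfl⟩
    exact hpα ν hν
  have hmem : ∀ ι < τ, σ + ι ∈ p'.topSet := by
    intro ι hι
    have h1 : σ + ι ∈ (q.stem.cond hp).topSet := by
      rw [Stem.topSet_cond]
      exact ⟨ν₀ + ι, hν₀ι ι hι, glue_add⟩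
    exact hp'.subset h1
  obtain ⟨m, hm, hmσ⟩ := exists_enum_eq (p := p') (add_zero σ ▸ hmem 0 hτlim.bot_lt)
  -- The block is also consecutive in the enumeration of p', starting at index m.
  have hmι := StrictMonoOn.add_of_covers p'.enum_strictMonoOn hm (τ := τ) (by
    rw [hmσ, p'.image_enum]
    exact hmem)
  rw [hmσ] at hmι
  have hsplit : p'.stem.Splitting p'.height m τ :=
    ⟨p'.isTop.sub, fun ι hι => (hmι ι hι).1, fun _ =>
      ⟨p'.isTop.sloop.isSuccLimit_of_map hm (hmσ ▸ hσlim), p'.isTop.limit⟩⟩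
  have hΘ : p'.stem.lam + ω ^ (p'.height + τ) < κ.ord :=
    add_lt_ord hκ.le p'.stem.lam_lt
      (omega0_opow_lt_ord hκ (add_lt_ord hκ.le p'.height_lt_ord hτκ))
  have hqα : ∀ ι < τ, α ≤ q.enum (ν₀ + ι) := fun ι hι => not_lt.1 fun h =>
    absurd ((hcut _ (hν₀ι ι hι)).2 h) (not_lt.2 le_self_add)
  -- The copy of the block takes the indices following all of p', since its values in q are at least
  -- α whereas S^p' lies below α.
  have hr : (hsplit.extend hκ.le hΘ).IsTop (p'.height + τ)
      (glue p'.height p'.enum fun ι => q.enum (ν₀ + ι)) := by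
    refine ⟨isSuccLimit_add _ hτlim, ?_, hsplit.Iio_subset_level hκ.le hΘ, fun ν hν => ?_⟩
    · refine IsSLOOP.glue p'.isTop.limit p'.isTop.sloop (fun ι hι => ?_) (fun ι hι h => ?_)
        (fun ι ι' h hι' => ?_) fun h γ hγ => ?_
      · rw [← add_assoc]
        exact q.isTop.sloop.map_succ _ (add_assoc ν₀ ι 1 ▸ hν₀ι _ hι)
      · refine q.isTop.sloop.map_limit _ (hν₀ι ι hι) ?_
        rcases h with rfl | h
        · rwa [add_zero]
        · exact isSuccLimit_add _ h
      · exact q.isTop.sloop.map_lt _ _ (by gcongr) (hν₀ι ι' hι')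
      · exact (hp'α (enum_mem hγ)).trans_le (hqα 0 h)
    · rcases lt_add_cases hν with h | ⟨ι, hι, rfl⟩
      · rw [glue_of_lt h]
        exact p'.isTop.lt ν h
      · rw [glue_add]
        exact q.isTop.lt _ (hν₀ι ι hι)
  have hrp' := extends_of_splitting hsplit hκ.le hΘ hr le_self_add fun ν hν => glue_of_lt hν
  refine ⟨_, hrp', ?_⟩
  have hrp := hrp'.trans hp'
  have hbase : ∀ ι < τ, (hsplit.attachment (p'.height + τ)).base
      ((hsplit.extend hκ.le hΘ).lam, p'.height + ι) (m + ι) := by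
    intro ι hι
    refine hsplit.base_add (y := ((hsplit.extend hκ.le hΘ).lam, p'.height + ι)) ?_ hι rfl
    have hlt' : p'.height + ι < p'.height + τ := by gcongr
    rcases hr.sub hlt' with h1 | h1
    · exact absurd (hsplit.lam_lt_extend hκ.le hΘ) (not_lt.2 (p'.stem.bound h1).1)
    · exact h1
  have hlow : ∀ {x : Node.{u}}, x ∈ q.S → x.1 ≤ q.lam → x ∈ (q.stem.cond hp).S :=
    fun hx hl => Or.inl ⟨hx, hl⟩
  have hpσ : ∀ ι < τ, ∀ x, (q.stem.cond hp).rel x (κ.ord, σ + ι) ↔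
      q.rel x (κ.ord, q.enum (ν₀ + ι)) := by
    intro ι hι x
    have h1 := Stem.cond_rel_top hp (x := x) (hν₀ι ι hι)
    rw [glue_add] at h1
    rw [h1, rel_enum_iff (hν₀ι ι hι)]
    rfl
  have hpν : ∀ ν < ν₀, ∀ x, (q.stem.cond hp).rel x (κ.ord, q.enum ν) ↔
      q.rel x (κ.ord, q.enum ν) := by
    intro ν hν x
    have h1 := Stem.cond_rel_top hp (x := x) (hν.trans hlt)
    rw [glue_of_lt hν] at h1
    rw [h1, rel_enum_iff (hν.trans hlt)]
    rfl
  have hp'σ : ∀ ι < τ, ∀ x, p'.rel x (κ.ord, σ + ι) ↔ p'.stem.le x (p'.lam, m + ι) := by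
    intro ι hι x
    rw [← (hmι ι hι).2]
    exact rel_enum_iff (hmι ι hι).1
  have hσmem : ∀ ι < τ, (κ.ord, σ + ι) ∈ (q.stem.cond hp).S := fun ι hι =>
    Or.inr ⟨rfl, ν₀ + ι, hν₀ι ι hι, glue_add⟩
  have hνmem : ∀ ν < ν₀, (κ.ord, q.enum ν) ∈ (q.stem.cond hp).S := fun ν hν =>
    Or.inr ⟨rfl, ν, hν.trans hlt, glue_of_lt hν⟩
  have hAι : ∀ ι < τ, p'.height + ι < p'.height + τ := fun ι hι => by gcongr
  have hrι : ∀ ι < τ, ∀ x : Node.{u}, x.1 ≤ p'.lam →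
      (((hsplit.extend hκ.le hΘ).cond hr).rel x (κ.ord, q.enum (ν₀ + ι)) ↔
        p'.stem.le x (p'.lam, m + ι)) := by
    intro ι hι x hx
    have h1 := Stem.cond_rel_top hr (x := x) (hAι ι hι)
    rw [glue_add] at h1
    exact h1.trans (hsplit.extend_le_iff hκ.le hΘ hx (hbase ι hι))
  have hqp' : q.lam ≤ p'.lam := hp'.mangal.1
  have htop : ∀ ι < τ, ∀ x ∈ q.S, x.1 ≤ q.lam →
      (q.rel x (κ.ord, q.enum (ν₀ + ι)) ↔ p'.stem.le x (p'.lam, m + ι)) := by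
    intro ι hι x hx hl
    rw [← hpσ ι hι, hp'.rel_iff x (hlow hx hl) _ (hσmem ι hι), hp'σ ι hι]
  have hcases : ∀ {y : Node.{u}}, y ∈ q.S → y.1 ≤ q.lam ∨ (∃ ν < ν₀, y = (κ.ord, q.enum ν)) ∨
      ∃ ι < τ, y = (κ.ord, q.enum (ν₀ + ι)) := by
    intro y hy
    rcases q.mem_cases hy with hl | ⟨ν, hν, rfl⟩
    · exact Or.inl hl
    · rw [hτ] at hν
      rcases lt_add_cases hν with h | ⟨ι, hι, rfl⟩
      · exact Or.inr (Or.inl ⟨ν, h, rfl⟩)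
      · exact Or.inr (Or.inr ⟨ι, hι, rfl⟩)
  refine ⟨?_, ?_, ?_, ?_, hrp.mangal⟩
  · intro x hx
    rcases hcases hx with hl | ⟨ν, hν, rfl⟩ | ⟨ι, hι, rfl⟩
    · exact hrp.subset (hlow hx hl)
    · exact hrp.subset (hνmem ν hν)
    · exact Or.inr ⟨rfl, p'.height + ι, hAι ι hι, glue_add⟩
  · ext x
    constructor
    · rintro ⟨hx, hl⟩
      exact ⟨hrp.subset (hlow hx hl.1), hl⟩
    · rintro ⟨hx, hl⟩
      rcases hrp.mem_of_le_lam hx hl.1 with h1 | h1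
      · exact ⟨h1.1, hl⟩
      · exact absurd hl.1 (not_le.2 (h1.1 ▸ q.lam_lt))
  · intro x hx y hy
    rcases q.mem_cases hx with hxl | ⟨μ, -, rfl⟩
    · rcases hcases hy with hl | ⟨ν, hν, rfl⟩ | ⟨ι, hι, rfl⟩
      · rw [← hrp.rel_iff x (hlow hx hxl) y (hlow hy hl), Stem.cond_rel_of_le_lam hp hl,
          stem_rel_iff]
        exact (and_iff_left hl).symm
      · rw [← hrp.rel_iff x (hlow hx hxl) _ (hνmem ν hν), hpν ν hν]
      · rw [htop ι hι x hx hxl, hrι ι hι x (hxl.trans hqp')]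
    · exact ⟨fun h => absurd (q.level_le_of_rel h) (not_le.2 q.lam_lt),
        fun h => absurd (level_le_of_rel h) (not_le.2 (MorassCondition.lam_lt _))⟩
  · intro x y hxy γ hγ
    obtain ⟨hx, hy⟩ := q.tree.mem _ _ hxy
    have hxl := q.level_le_of_rel hxy
    rcases hcases hy with hl | ⟨ν, hν, rfl⟩ | ⟨ι, hι, rfl⟩
    · have h1 : q.stem.rel x y := ⟨hxy, hl⟩
      rw [← hrp.π_eq x y ((Stem.cond_rel_of_le_lam hp hl).2 h1) γ hγ, Stem.cond_π_of_rel hp h1,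
        stem_π h1]
    · have h1 := (rel_enum_iff (hν.trans hlt)).1 hxy
      have h2 : q.stem.pi x (q.stem.lam, ν) γ ≤ ν := Frame.pi_le h1 hγ
      have h3 := Stem.cond_π_top hp (hν.trans hlt) h1 hγ
      rw [glue_of_lt hν, glue_of_lt (h2.trans_lt hν)] at h3
      rw [← hrp.π_eq x _ ((hpν ν hν x).2 hxy) γ hγ, h3]
      exact π_enum (hν.trans hlt) h1 hγ
    · have h1 := (rel_enum_iff (hν₀ι ι hι)).1 hxy
      have h2 : q.stem.pi x (q.stem.lam, ν₀ + ι) γ ≤ ν₀ + ι := Frame.pi_le h1 hγ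
      have h3 := Stem.cond_π_top hp (hν₀ι ι hι) h1 hγ
      have h4 := (htop ι hι x hx hxl).1 hxy
      have h5 : p'.stem.pi x (p'.lam, m + ι) γ ≤ m + ι := Frame.pi_le h4 hγ
      have h6 := π_enum (hmι ι hι).1 h4 hγ
      have h7 := Stem.cond_π_top hr (hAι ι hι)
        ((hsplit.extend_le_iff hκ.le hΘ (hxl.trans hqp') (hbase ι hι)).2 h4) hγ
      have h8 : (hsplit.extend hκ.le hΘ).pi x
          ((hsplit.extend hκ.le hΘ).lam, p'.height + ι) γ = Stem.splitMap p'.height m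
            (p'.height + ι) (p'.stem.pi x (p'.lam, m + ι) γ) :=
        hsplit.extend_pi hκ.le hΘ (hbase ι hι) h4 hγ
      rw [glue_add, h8] at h7
      rw [glue_add, hp'.π_eq x _ ((hpσ ι hι x).2 hxy) γ hγ, ← (hmι ι hι).2, h6] at h3
      rw [h7, π_enum (hν₀ι ι hι) h1 hγ]
      change _ = glue ν₀ q.enum (fun ι => σ + ι) (q.stem.pi x (q.lam, ν₀ + ι) γ) at h3
      change q.stem.pi x (q.lam, ν₀ + ι) γ ≤ _ at h2
      -- By `h3`, j and k index the same element in the enumerations of p' and p. If k < ν₀, this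
      -- element is below σ, so j < m and j is not moved. If k = ν₀ + ι', then j = m + ι' is moved
      -- to the index of q.enum (ν₀ + ι').
      generalize p'.stem.pi x (p'.lam, m + ι) γ = j at h3 h5 ⊢
      generalize q.stem.pi x (q.lam, ν₀ + ι) γ = k at h2 h3 ⊢
      have hj : j < p'.height := h5.trans_lt (hmι ι hι).1
      rcases lt_or_exists_eq_add k ν₀ with hk | ⟨ι', rfl⟩
      · rw [glue_of_lt hk] at h3
        have hjm : j < m := by
          rw [← p'.isTop.sloop.lt_iff hj hm, h3, hmσ]
          exact hσb k hk
        rw [Stem.splitMap_of_lt_of_le le_self_add hjm, glue_of_lt hj, h3]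
      · have hι' : ι' < τ := (le_of_add_le_add_left h2).trans_lt hι
        rw [glue_add, ← (hmι ι' hι').2] at h3
        rw [p'.isTop.sloop.inj hj (hmι ι' hι').1 h3, Stem.splitMap_add le_self_add, glue_add]

/-! ### Failure of reductions for small cofinality -/

/-- New levels above the one-node stem provide enough room. With A = τ = 0 nothing is attached to
the root, so no relation to it has to be respected. -/
theorem exists_condition_of_set (hκ : Cardinal.aleph0 < κ) {S : Set Ordinal.{u}}
    (hS : ∀ β ∈ S, β < (Order.succ κ).ord) (h0 : 0 ∈ S) (hs : ∀ β ∈ S, β + 1 ∈ S)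
    (hp : ∀ β, β + 1 ∈ S → β ∈ S) (hcard : Cardinal.mk S < Cardinal.lift.{u + 1} κ) :
    ∃ q : MorassCondition κ, q.topSet = S := by
  obtain ⟨ot, f, hf, hfS⟩ := exists_enumeration hS
  obtain ⟨hsl, hlim⟩ := IsSLOOP.of_enum hf hfS h0 hs hp
  have hot : ot < κ.ord := by
    rw [Cardinal.lt_ord, ← Cardinal.lift_lt.{u, u + 1}, ← Cardinal.mk_Iio_ordinal,
      ← Cardinal.mk_image_eq_of_injOn _ _ hf.injOn, hfS]
    exact hcard
  have h : (Stem.root hκ).Splitting 0 0 0 :=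
    ⟨by simp, fun ι hι => absurd hι not_lt_zero, fun h => absurd h (lt_irrefl _)⟩
  have hΘ : (Stem.root hκ).lam + ω ^ ot < κ.ord :=
    add_lt_ord hκ.le (Stem.lam_lt _) (omega0_opow_lt_ord hκ hot)
  have ht : (h.extend hκ.le hΘ).IsTop ot f := ⟨hlim, hsl, h.Iio_subset_level hκ.le hΘ,
    fun ν hν => hS _ (hfS ▸ ⟨ν, hν, rfl⟩)⟩
  exact ⟨(h.extend hκ.le hΘ).cond ht, by rw [Stem.topSet_cond, hfS]⟩

theorem exists_condition_cofinal (hκ : Cardinal.aleph0 < κ) {α : Ordinal.{u}}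
    (hα : IsSuccLimit α) (hακ : α < (Order.succ κ).ord) (hcof : α.cof < κ) :
    ∃ q : MorassCondition κ, α ∈ q.topSet ∧ ∀ β < α, ∃ ξ ∈ q.topSet, β < ξ ∧ ξ < α := by
  obtain ⟨s, hs, hcard⟩ := Order.exists_cof_eq (Set.Iio α)
  rw [cof_Iio, ← lift_cof] at hcard
  set C : Set Ordinal.{u} := insert 0 (insert α (Subtype.val '' s)) with hC
  -- The equation says that β is finitely many steps from c, in either direction, so closure under
  -- successors and predecessors adds only countably many elements per c.
  set S : Set Ordinal.{u} := {β | ∃ c ∈ C, ∃ m n : ℕ, β + m = c + n} with hS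
  have hCS : C ⊆ S := fun c hc => ⟨c, hc, 0, 0, rfl⟩
  have hinf : Cardinal.aleph0 ≤ Cardinal.lift.{u + 1} κ := by simpa using hκ.le
  have hCcard : Cardinal.mk C < Cardinal.lift.{u + 1} κ := by
    have h1 : Cardinal.mk (Subtype.val '' s : Set Ordinal.{u}) < Cardinal.lift.{u + 1} κ := by
      refine Cardinal.mk_image_le.trans_lt ?_
      rw [hcard]
      exact Cardinal.lift_lt.2 hcof
    have h2 : (1 : Cardinal.{u + 1}) < Cardinal.lift.{u + 1} κ :=
      Cardinal.one_lt_aleph0.trans_le hinf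
    exact (Cardinal.mk_insert_le).trans_lt (Cardinal.add_lt_of_lt hinf
      ((Cardinal.mk_insert_le).trans_lt (Cardinal.add_lt_of_lt hinf h1 h2)) h2)
  have hScard : Cardinal.mk S < Cardinal.lift.{u + 1} κ := by
    have hle : Cardinal.mk S ≤ Cardinal.mk (C × ℕ × ℕ) := by
      have hch : ∀ β : S, ∃ t : C × ℕ × ℕ, (β : Ordinal.{u}) + t.2.1 = t.1 + t.2.2 := by
        rintro ⟨β, c, hc, m, n, e⟩
        exact ⟨⟨⟨c, hc⟩, m, n⟩, e⟩
      choose g hg using hch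
      refine Cardinal.mk_le_of_injective (f := g) fun β γ e => Subtype.ext ?_
      have h1 := hg β
      rw [e, ← hg γ] at h1
      -- Finite right summands cancel, so β is determined by c, m and n.
      exact (Ordinal.add_right_cancel _).1 h1
    refine hle.trans_lt ?_
    rw [Cardinal.mk_prod, Cardinal.lift_id'.{0, u + 1}]
    refine Cardinal.mul_lt_of_lt hinf (by simpa using hCcard) ?_
    refine lt_of_le_of_lt (b := Cardinal.aleph0) (by simp) ?_
    simpa using hκ
  have hsucc : IsSuccLimit (Order.succ κ).ord :=
    Cardinal.isSuccLimit_ord (hκ.le.trans (Order.le_succ κ))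
  have hSlt : ∀ β ∈ S, β < (Order.succ κ).ord := by
    rintro β ⟨c, hc, m, n, e⟩
    refine (le_self_add.trans e.le).trans_lt (hsucc.add_natCast_lt ?_ n)
    rcases hc with rfl | rfl | ⟨c, -, rfl⟩
    · exact hsucc.bot_lt
    · exact hακ
    · exact c.2.trans hακ
  have hSs : ∀ β ∈ S, β + 1 ∈ S := by
    rintro β ⟨c, hc, m, n, e⟩
    refine ⟨c, hc, m, n + 1, ?_⟩
    push_cast
    have h1 : (1 : Ordinal.{u}) + m = m + 1 := by exact_mod_cast add_comm 1 m
    rw [← add_assoc, ← e, add_assoc, add_assoc, h1]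
  have hSp : ∀ β, β + 1 ∈ S → β ∈ S := by
    rintro β ⟨c, hc, m, n, e⟩
    refine ⟨c, hc, 1 + m, n, ?_⟩
    rw [← e]
    push_cast
    rw [add_assoc]
  obtain ⟨q, hq⟩ := exists_condition_of_set hκ hSlt (hCS (Or.inl rfl)) hSs hSp hScard
  refine ⟨q, hq ▸ hCS (Or.inr (Or.inl rfl)), fun β hβ => ?_⟩
  obtain ⟨⟨c, hc⟩, hcs, hle⟩ := hs ⟨β + 1, hα.succ_lt hβ⟩
  exact ⟨c, hq ▸ hCS (Or.inr (Or.inr ⟨_, hcs, rfl⟩)), (lt_add_one β).trans_le hle, hc⟩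

/-- Fresh levels above s, with S^s unchanged, turn the new top level into a mangal whose nodes above
old ones all have order below the height of s. The path to ⟨κ, α⟩ in a common extension with q would
need a node there lying beyond a cofinal subset of S^s. -/
theorem exists_incompatible (hκ : Cardinal.aleph0 < κ) {α : Ordinal.{u}} {q s : MorassCondition κ}
    (hαq : α ∈ q.topSet) (hq : ∀ β < α, ∃ ξ ∈ q.topSet, β < ξ ∧ ξ < α)
    (hsα : s.topSet ⊆ Set.Iio α) (hqs : q.topSet ∩ Set.Iio α ⊆ s.topSet) (hlam : q.lam ≤ s.lam) :
    ∃ p' : MorassCondition κ, p'.Extends s ∧ p'.topSet ⊆ Set.Iio α ∧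
      ∀ r : MorassCondition κ, r.Extends p' → ¬ r.Extends q := by
  have h : s.stem.Splitting s.height 0 0 :=
    ⟨s.isTop.sub, fun ι hι => absurd hι not_lt_zero, fun h => absurd h (lt_irrefl _)⟩
  have hΘ : s.stem.lam + ω ^ s.height < κ.ord :=
    add_lt_ord hκ.le (Stem.lam_lt _) (omega0_opow_lt_ord hκ s.height_lt_ord)
  have ht : (h.extend hκ.le hΘ).IsTop s.height s.enum :=
    ⟨s.isTop.limit, s.isTop.sloop, h.Iio_subset_level hκ.le hΘ, s.isTop.lt⟩
  refine ⟨_, extends_of_splitting h hκ.le hΘ ht le_rfl fun _ _ => rfl, ?_, fun r hrp hrq => ?_⟩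
  · rw [Stem.topSet_cond, s.image_enum]
    exact hsα
  obtain ⟨ν₀, hν₀, rfl⟩ := exists_enum_eq hαq
  have hlt : s.lam < (h.extend hκ.le hΘ).lam := h.lam_lt_extend hκ.le hΘ
  have hxy := hrq.rel (enum_rel hν₀)
  -- The mangal interpolates a node of order μ at the new top level between ⟨λ^q, ν₀⟩ and ⟨κ, α⟩.
  obtain ⟨⟨a, μ⟩, hz, rfl, hxz, hzy⟩ := hrp.mangal.2 _ (r.tree.mem _ _ hxy).1 _
    (r.tree.mem _ _ hxy).2 hxy (hlam.trans_lt hlt) (MorassCondition.lam_lt _)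
  have hxz' := (hrp.rel_iff _ (hrp.mem_of_le_lam (r.tree.mem _ _ hxz).1 (hlam.trans hlt.le)) _
    (hrp.mem_of_le_lam hz le_rfl)).2 hxz
  rw [Stem.cond_rel_of_le_lam ht (by exact le_rfl)] at hxz'
  obtain ⟨ν, ⟨-, hb⟩, -⟩ := (Attachment.stack_rel_of_lt_lam (by exact hlam) (by exact hlt)).1 hxz'
  have hμ : μ < s.height := by
    rcases hb with hb | ⟨ι, hι, -⟩
    · exact hb.1
    · exact absurd hι not_lt_zero
  -- An element ξ of S^q is chosen between s.enum μ and α. It has index ν' < ν₀ in q and index j' in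
  -- s.
  obtain ⟨ξ, hξ, h1, h2⟩ := hq _ (hsα (enum_mem hμ))
  obtain ⟨j', hj', e'⟩ := exists_enum_eq (hqs ⟨hξ, h2⟩)
  obtain ⟨ν', hν', e⟩ := exists_enum_eq hξ
  have hνν : ν' < ν₀ := by
    rw [← q.isTop.sloop.lt_iff hν' hν₀, e]
    exact h2
  have hj : r.π (q.lam, ν₀) ((h.extend hκ.le hΘ).lam, μ) ν' < μ := r.frame.π_lt hxz hνν
  have hπ : r.π ((h.extend hκ.le hΘ).lam, μ) (κ.ord, q.enum ν₀)
      (r.π (q.lam, ν₀) ((h.extend hκ.le hΘ).lam, μ) ν') = ξ := by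
    have h3 := r.comm _ _ _ hxz hzy ν' hνν.le
    rw [← hrq.π_eq _ _ (enum_rel hν₀) ν' hνν.le, π_enum_self hν₀ hνν.le, e] at h3
    exact h3
  have h4 := (r.M2 _ _ hzy _ hj).1
  change r.rel _ (κ.ord, r.π ((h.extend hκ.le hΘ).lam, μ) (κ.ord, q.enum ν₀) _) at h4
  rw [hπ] at h4
  have h5 := hrp.rel ((Stem.cond_rel_top ht (x := ((h.extend hκ.le hΘ).lam, j')) hj').2 (Or.inl rfl))
  rw [e'] at h5
  -- Uniqueness of the predecessor of ⟨κ, ξ⟩ at this level identifies the image of ν' with j'. Hence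
  -- j' < μ, so ξ < s.enum μ, contrary to the choice of ξ.
  have h6 := (Prod.ext_iff.1 (r.frame.eq_of_rel_of_level_eq h4 h5 rfl)).2
  change r.π (q.lam, ν₀) ((h.extend hκ.le hΘ).lam, μ) ν' = j' at h6
  rw [h6, ← s.isTop.sloop.lt_iff hj' hμ, e'] at hj
  exact absurd hj (not_lt.2 h1.le)

end Mangrove

/-! ### The characterization of complete inclusions -/

theorem mainTheorem12 (κ : Cardinal.{u}) (hreg : κ.IsRegular) (hunc : Cardinal.aleph0 < κ)
    (α : Ordinal.{u}) (hlim : Order.IsSuccLimit α) (hα : α ≤ (Order.succ κ).ord) :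
    Mangrove.IsCompleteEmbedding
        (fun p : Mangrove.RestrictedForcing κ α => (p : Mangrove.Forcing κ)) ↔
      α.cof = κ ∨ α = (Order.succ κ).ord := by
  constructor
  · intro hE
    by_contra! hne
    have hlt : α < (Order.succ κ).ord := hα.lt_of_ne hne.2
    have hcof : α.cof < κ := by
      refine lt_of_le_of_ne ((Ordinal.cof_le_card α).trans ?_) hne.1
      exact Order.lt_succ_iff.1 (Cardinal.lt_ord.1 hlt)
    obtain ⟨q, hαq, hq⟩ := Mangrove.exists_condition_cofinal hunc hlim hlt hcof
    obtain ⟨p, hp⟩ := hE.reduction (q : Mangrove.Forcing κ)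
    obtain ⟨r, hrp, hrq⟩ := hp p le_rfl
    obtain ⟨r, rfl⟩ := WithTop.ne_top_iff_exists.1 (ne_top_of_le_ne_top WithTop.coe_ne_top hrq)
    have hrq' : r.Extends q := WithTop.coe_le_coe.1 hrq
    -- The restriction s stays below the alleged reduction p, and retains both the height λ^r ≥ λ^q
    -- and all of S^q ∩ α.
    obtain ⟨s, hsl, hst, hs⟩ := r.exists_restriction hlim
    obtain ⟨p', hp's, hp'α, hinc⟩ := Mangrove.exists_incompatible hunc hαq hq
      (hst ▸ Set.inter_subset_right)
      (hst ▸ Set.inter_subset_inter_left _ fun β hβ => hrq'.subset hβ) (hsl ▸ hrq'.mangal.1)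
    obtain ⟨t, htp, htq⟩ := hp
      ⟨(p' : Mangrove.Forcing κ), fun c hc => WithTop.coe_injective hc ▸ hp'α⟩ (by
        change (p' : Mangrove.Forcing κ) ≤ p.1
        by_cases htop : p.1 = ⊤
        · rw [htop]
          exact le_top
        · obtain ⟨c, hc⟩ := WithTop.ne_top_iff_exists.1 htop
          rw [← hc] at hrp ⊢
          exact WithTop.coe_le_coe.2
            (hp's.trans (hs c (WithTop.coe_le_coe.1 hrp) (p.2 c hc.symm))))
    obtain ⟨t, rfl⟩ := WithTop.ne_top_iff_exists.1 (ne_top_of_le_ne_top WithTop.coe_ne_top htq)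
    exact hinc t (WithTop.coe_le_coe.1 htp) (WithTop.coe_le_coe.1 htq)
  · intro hc
    have hcof : κ ≤ α.cof := by
      rcases hc with h | rfl
      · exact h.ge
      · rw [(Cardinal.isRegular_succ hreg.aleph0_le).cof_ord]
        exact Order.le_succ κ
    refine ⟨fun p p' h => h, fun p p' => not_congr ⟨?_, ?_⟩, fun q => ?_⟩
    · rintro ⟨r, h1, h2⟩
      exact ⟨r, h1, h2⟩
    · rintro ⟨r, h1, h2⟩
      by_cases htop : r = ⊤
      · refine ⟨⟨⊤, fun c hc => absurd hc.symm WithTop.coe_ne_top⟩, ?_, ?_⟩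
        · exact htop ▸ h1
        · exact htop ▸ h2
      · obtain ⟨r, rfl⟩ := WithTop.ne_top_iff_exists.1 htop
        -- A common extension in the large forcing restricts to one in the small forcing.
        obtain ⟨s, -, hst, hs⟩ := r.exists_restriction hlim
        have hle : ∀ p : Mangrove.RestrictedForcing κ α, (r : Mangrove.Forcing κ) ≤ p.1 →
            (s : Mangrove.Forcing κ) ≤ p.1 := by
          intro p hrp
          by_cases htop : p.1 = ⊤
          · rw [htop]
            exact le_top
          · obtain ⟨c, hc⟩ := WithTop.ne_top_iff_exists.1 htop
            rw [← hc] at hrp ⊢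
            exact WithTop.coe_le_coe.2 (hs c (WithTop.coe_le_coe.1 hrp) (p.2 c hc.symm))
        exact ⟨⟨s, fun c hc => WithTop.coe_injective hc ▸ hst ▸ Set.inter_subset_right⟩,
          hle p h1, hle p' h2⟩
    · by_cases htop : q = ⊤
      · exact ⟨⟨⊤, fun c hc => absurd hc.symm WithTop.coe_ne_top⟩,
          fun p' _ => ⟨p', le_rfl, htop ▸ le_top⟩⟩
      · obtain ⟨q, rfl⟩ := WithTop.ne_top_iff_exists.1 htop
        obtain ⟨p, hpα, hp⟩ := Mangrove.exists_reduction hunc hlim hα hcof q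
        refine ⟨⟨p, fun c hc => WithTop.coe_injective hc ▸ hpα⟩, fun p' hp' => ?_⟩
        have hp'' : p'.1 ≤ (p : Mangrove.Forcing κ) := hp'
        obtain ⟨c, hc⟩ := WithTop.ne_top_iff_exists.1
          (ne_top_of_le_ne_top WithTop.coe_ne_top hp'')
        rw [← hc] at hp''
        obtain ⟨r, h1, h2⟩ := hp c (WithTop.coe_le_coe.1 hp'') (p'.2 c hc.symm)
        refine ⟨(r : Mangrove.Forcing κ), ?_, WithTop.coe_le_coe.2 h2⟩
        change (r : Mangrove.Forcing κ) ≤ p'.1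
        rw [← hc]
        exact WithTop.coe_le_coe.2 h1
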